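/- **Conventions.** For nonempty bounded metric spaces $X,Y$, $d_{\mathrm{GH}}(X,Y)=\tfrac12\inf_R \mathrm{dis}(R)$ is the Gromov–Hausdorff distance, where $R\subseteq X\times Y$ runs over all correspondences (relations that are total on both sides) and $\mathrm{dis}(R)=\sup\{|d(x,x')-d(y,y')| : (x,y),(x',y')\in R\}$. The first Betti number $\beta_1(X)$ is the dimension of the first singular homology of $X$ with real coefficients. A *finite metric graph* is a nonempty (hence connected) length space homeomorphic to a finite topological graph; loops and multiple edges are allowed, and so is a single point. For a compact geodesic space $X$ and an integer $n\ge 0$ put $$\delta^X_n:=\inf\{d_{\mathrm{GH}}(X,G) : G \text{ a finite metric graph},\ \beta_1(G)\le n\}.$$ The hyperbolicity $\mathrm{hyp}(X)$ is the least $\delta\ge 0$ such that for all $x,y,w,z\in X$ $$d(x,y)+d(w,z)\le \max\big(d(x,w)+d(y,z),\,d(x,z)+d(y,w)\big)+2\delta .$$ For $p\in X$ let $g_p(x,y)=\tfrac12\big(d(p,x)+d(p,y)-d(x,y)\big)$ be the Gromov product and $$g_p^\infty(x,y)=\sup_{x=x_0,\dots,x_m=y}\ \min_{1\le i\le m} g_p(x_{i-1},x_i),$$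 the supremum being over all finite chains ($m\ge1$) from $x$ to $y$. *Gromov's tree* $\mathrm T_pX$ is the metric space associated to the pseudo-metric $t_p(x,y)=d(p,x)+d(p,y)-2g_p^\infty(x,y)$ on $X$ (points at $t_p$-distance $0$ are identified). **Theorem.** Let $X$ be a compact geodesic metric space with finite first Betti number $\beta=\beta_1(X)$, let $p\in X$, and let $\tau^{X,p}:=d_{\mathrm{GH}}(X,\mathrm T_pX)$. Then: 1. $\dfrac{\tau^{X,p}}{6}\le \delta^X_0\le \tau^{X,p}$. 2. For every integer $n\ge 0$, $\ \delta^X_n\le\delta^X_0\le \log_2(4n+4)\,\big(5\,\delta^X_n+\mathrm{hyp}(X)\big)$. 3. If $G=X$ is a finite metric graph, then $\dfrac{\mathrm{hyp}(G)}{4}\le\delta^G_0\le \log_2(4\beta+4)\,\mathrm{hyp}(G)$. -/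

import Mathlib

noncomputable section

namespace TreeApprox

/-! ### Gromov-Hausdorff distance -/

/-- A correspondence between two sets: a relation that is total on both sides. -/
def IsCorrespondence {X Y : Type*} (R : X → Y → Prop) : Prop :=
  (∀ x, ∃ y, R x y) ∧ (∀ y, ∃ x, R x y)

/-- The metric distortion of a relation between two (bounded) metric spaces:
the supremum of `|d(x,x') - d(y,y')|` over all related pairs `(x,y)` and `(x',y')`. -/
def distortion {X Y : Type*} [MetricSpace X] [MetricSpace Y] (R : X → Y → Prop) : ℝ :=
  sSup {r : ℝ | ∃ x y x' y', R x y ∧ R x' y' ∧ r = |dist x x' - dist y y'|}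

/-- The Gromov-Hausdorff distance between nonempty bounded metric spaces, as half the infimum of
the distortions of all correspondences. -/
def dGH (X Y : Type*) [MetricSpace X] [MetricSpace Y] : ℝ :=
  1 / 2 * sInf {r : ℝ | ∃ R : X → Y → Prop, IsCorrespondence R ∧ r = distortion R}

/-! ### Geodesic spaces and length spaces -/

/-- A geodesic space: any two points are joined by a length minimizing geodesic, here
parametrized by arc length on `[0, d(x,y)]`. -/
def IsGeodesicSpace (X : Type*) [MetricSpace X] : Prop :=
  ∀ x y : X, ∃ γ : ℝ → X, γ 0 = x ∧ γ (dist x y) = y ∧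
    ∀ s ∈ Set.Icc 0 (dist x y), ∀ t ∈ Set.Icc 0 (dist x y), dist (γ s) (γ t) = |s - t|

/-- A length space: the distance between two points is the infimum of the lengths of the
continuous paths joining them.  (As distances are finite and `⨅` over an empty family is `⊤`, such
a space is path connected.) -/
def IsLengthSpace (X : Type*) [MetricSpace X] : Prop :=
  ∀ x y : X, edist x y = ⨅ γ : Path x y, eVariationOn γ Set.univ

/-! ### The first Betti number -/

/-- The first Betti number: the dimension of the first singular homology with real coefficients,
as an extended natural number (`⊤` if the dimension is infinite). -/
def firstBetti.{u} (X : Type u) [TopologicalSpace X] : ℕ∞ :=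
  Cardinal.toENat (Module.rank ℝ
    (((AlgebraicTopology.singularHomologyFunctor (ModuleCat.{u} ℝ) 1).obj
      (ModuleCat.of ℝ (ULift.{u} ℝ))).obj (TopCat.of X)))

/-! ### Finite metric graphs -/

/-- A (Hausdorff) space is a finite topological graph if there are a finite set `V` of vertices and
finitely many edges `e i`, i.e. paths with endpoints in `V` (loops and multiple edges are allowed),
such that the interiors of the edges are embedded, pairwise disjoint and disjoint from `V`, and
vertices and edges cover the space.  For a Hausdorff space this says that it is a finite
CW complex of dimension at most one. -/
def IsFiniteTopologicalGraph (G : Type*) [TopologicalSpace G] : Prop :=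
  ∃ (V : Set G) (m : ℕ) (e : Fin m → C(unitInterval, G)),
    V.Finite ∧
    (∀ i, e i 0 ∈ V ∧ e i 1 ∈ V) ∧
    (∀ i, ∀ s ∈ Set.Ioo (0 : unitInterval) 1, e i s ∉ V) ∧
    (∀ i j, ∀ s ∈ Set.Ioo (0 : unitInterval) 1, ∀ t ∈ Set.Ioo (0 : unitInterval) 1,
      e i s = e j t → i = j ∧ s = t) ∧
    (∀ x, x ∈ V ∨ ∃ i s, e i s = x)

/-- A finite metric graph: a nonempty length space that is homeomorphic to a finite topological
graph.  (It is connected because it is a length space.) -/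
structure IsFiniteMetricGraph (G : Type*) [MetricSpace G] : Prop where
  nonempty : Nonempty G
  isLengthSpace : IsLengthSpace G
  isFiniteTopologicalGraph : IsFiniteTopologicalGraph G

/-- `graphDelta X n` is the infimum of the Gromov-Hausdorff distances between `X` and the finite
metric graphs with first Betti number at most `n`.  (Up to isometry every finite metric graph
lives in `Type`.) -/
def graphDelta (X : Type*) [MetricSpace X] (n : ℕ) : ℝ :=
  sInf {r : ℝ | ∃ (G : Type) (_ : MetricSpace G),
    IsFiniteMetricGraph G ∧ firstBetti G ≤ n ∧ r = dGH X G}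

/-! ### Hyperbolicity -/

/-- The four point condition for `δ`-hyperbolicity. -/
def IsHyperbolic (X : Type*) [MetricSpace X] (δ : ℝ) : Prop :=
  ∀ x y w z : X, dist x y + dist w z ≤
    max (dist x w + dist y z) (dist x z + dist y w) + 2 * δ

/-- The hyperbolicity constant: the least `δ ≥ 0` such that `X` is `δ`-hyperbolic. -/
def hyp (X : Type*) [MetricSpace X] : ℝ := sInf {δ : ℝ | 0 ≤ δ ∧ IsHyperbolic X δ}

/-! ### Gromov's tree construction -/

section Tree

variable {X : Type*} [MetricSpace X]

/-- The Gromov product `g_p(x,y)`. -/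
def gromovProd (p x y : X) : ℝ := (dist p x + dist p y - dist x y) / 2

/-- The minimum of the Gromov products of consecutive members of the chain
`c 0, c 1, ..., c (n + 1)`. -/
def chainMin (p : X) (n : ℕ) (c : ℕ → X) : ℝ :=
  (Finset.range (n + 1)).inf' ⟨0, by simp⟩ (fun i => gromovProd p (c i) (c (i + 1)))

/-- `g_p^∞(x,y)`: the supremum over all finite chains from `x` to `y` of the minimum of the
Gromov products of consecutive members. -/
def gromovProdInf (p x y : X) : ℝ :=
  sSup {r : ℝ | ∃ (n : ℕ) (c : ℕ → X), c 0 = x ∧ c (n + 1) = y ∧ r = chainMin p n c}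

/-- Gromov's tree pseudo-metric `t_p`. -/
def treeDist (p x y : X) : ℝ := dist p x + dist p y - 2 * gromovProdInf p x y

theorem gromovProd_comm (p x y : X) : gromovProd p x y = gromovProd p y x := by
  simp only [gromovProd, dist_comm x y]; ring

theorem gromovProd_le_left (p x y : X) : gromovProd p x y ≤ dist p x := by
  have := dist_triangle p x y
  simp only [gromovProd]; linarith

theorem chainMin_le_left (p : X) (n : ℕ) (c : ℕ → X) : chainMin p n c ≤ dist p (c 0) :=
  (Finset.inf'_le _ (by simp : (0 : ℕ) ∈ Finset.range (n + 1))).trans (gromovProd_le_left _ _ _)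

theorem chain_bddAbove (p x y : X) :
    BddAbove {r : ℝ | ∃ (n : ℕ) (c : ℕ → X), c 0 = x ∧ c (n + 1) = y ∧ r = chainMin p n c} := by
  refine ⟨dist p x, ?_⟩
  rintro r ⟨n, c, rfl, -, rfl⟩
  exact chainMin_le_left p n c

theorem chain_nonempty (p x y : X) :
    {r : ℝ | ∃ (n : ℕ) (c : ℕ → X), c 0 = x ∧ c (n + 1) = y ∧ r = chainMin p n c}.Nonempty :=
  ⟨_, 0, fun i => if i = 0 then x else y, by simp, by simp, rfl⟩

theorem gromovProdInf_le_left (p x y : X) : gromovProdInf p x y ≤ dist p x := by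
  refine csSup_le (chain_nonempty p x y) ?_
  rintro r ⟨n, c, rfl, -, rfl⟩
  exact chainMin_le_left p n c

theorem chainMin_reverse (p : X) (n : ℕ) (c : ℕ → X) :
    chainMin p n c ≤ chainMin p n (fun i => c (n + 1 - i)) := by
  refine Finset.le_inf' _ _ fun i hi => ?_
  rw [Finset.mem_range] at hi
  refine (Finset.inf'_le _ (Finset.mem_range.2 (by omega) : n - i ∈ Finset.range (n + 1))).trans ?_
  rw [gromovProd_comm]
  have h1 : n - i + 1 = n + 1 - i := by omega
  have h2 : n - i = n + 1 - (i + 1) := by omega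
  rw [h1, h2]

theorem gromovProdInf_comm_le (p x y : X) : gromovProdInf p x y ≤ gromovProdInf p y x := by
  refine csSup_le (chain_nonempty p x y) ?_
  rintro r ⟨n, c, hx, hy, rfl⟩
  refine (chainMin_reverse p n c).trans (le_csSup (chain_bddAbove p y x) ?_)
  exact ⟨n, fun i => c (n + 1 - i), by simpa using hy, by simpa using hx, rfl⟩

theorem gromovProdInf_comm (p x y : X) : gromovProdInf p x y = gromovProdInf p y x :=
  le_antisymm (gromovProdInf_comm_le p x y) (gromovProdInf_comm_le p y x)

theorem gromovProdInf_self (p x : X) : gromovProdInf p x x = dist p x := by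
  refine le_antisymm (gromovProdInf_le_left p x x) (le_csSup (chain_bddAbove p x x) ?_)
  exact ⟨0, fun _ => x, rfl, rfl, by simp [chainMin, gromovProd]⟩

theorem min_gromovProdInf_le (p x y z : X) :
    min (gromovProdInf p x y) (gromovProdInf p y z) ≤ gromovProdInf p x z := by
  refine le_of_forall_lt fun r hr => ?_
  obtain ⟨h1, h2⟩ := lt_min_iff.1 hr
  obtain ⟨_, ⟨n, c, hcx, hcy, rfl⟩, hc⟩ := exists_lt_of_lt_csSup (chain_nonempty p x y) h1
  obtain ⟨_, ⟨m, d, hdy, hdz, rfl⟩, hd⟩ := exists_lt_of_lt_csSup (chain_nonempty p y z) h2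
  have key : r < chainMin p (n + 1 + m) (fun i => if i ≤ n + 1 then c i else d (i - (n + 1))) := by
    refine (Finset.lt_inf'_iff _).2 fun i hi => ?_
    rw [Finset.mem_range] at hi
    rcases lt_trichotomy i (n + 1) with h | h | h
    · have := (Finset.lt_inf'_iff _).1 hc i (by simpa using h)
      simpa [h.le, Nat.le_of_lt_succ h] using this
    · have := (Finset.lt_inf'_iff _).1 hd 0 (by simp)
      subst h
      simpa [hcy, hdy] using this
    · have := (Finset.lt_inf'_iff _).1 hd (i - (n + 1)) (by simp; omega)
      have e : i + 1 - (n + 1) = i - (n + 1) + 1 := by omega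
      simpa only [if_neg (show ¬ i ≤ n + 1 by omega),
        if_neg (show ¬ i + 1 ≤ n + 1 by omega), e] using this
  refine key.trans_le (le_csSup (chain_bddAbove p x z) ⟨_, _, ?_, ?_, rfl⟩)
  · simp [hcx]
  · have e : n + 1 + m + 1 - (n + 1) = m + 1 := by omega
    rw [if_neg (by omega), e, hdz]

theorem treeDist_triangle (p x y z : X) :
    treeDist p x z ≤ treeDist p x y + treeDist p y z := by
  have h := min_gromovProdInf_le p x y z
  have h1 := gromovProdInf_le_left p y z
  have h2 := gromovProdInf_le_left p y x
  rw [gromovProdInf_comm] at h2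
  simp only [treeDist]
  rcases min_le_iff.1 h with h | h <;> linarith

/-- A copy of the set `X`, to be endowed with the pseudo-metric `t_p`. -/
def PreGromovTree (X : Type*) [MetricSpace X] (_p : X) : Type _ := X

instance (p : X) : PseudoMetricSpace (PreGromovTree X p) where
  dist x y := treeDist (X := X) p x y
  dist_self x := by
    have := gromovProdInf_self (X := X) p x
    simp only [treeDist] at *; linarith
  dist_comm x y := by
    simp only [treeDist, gromovProdInf_comm (X := X) p x y]; ring
  dist_triangle x y z := treeDist_triangle (X := X) p x y z

/-- Gromov's tree `T_p X`: the metric space associated to the pseudo-metric `t_p` on `X`, obtained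
by identifying points at `t_p`-distance zero. -/
abbrev GromovTree (X : Type*) [MetricSpace X] (p : X) : Type _ :=
  SeparationQuotient (PreGromovTree X p)

end Tree

end TreeApprox

end

open Filter Topology
open scoped unitInterval ENNReal

universe u

noncomputable section

namespace TreeApprox

/-! ### First homology: contractible spaces and winding numbers -/

section Homology

open CategoryTheory Limits AlgebraicTopology Simplicial

/-! Everything is governed by the gap between `gromovProdInf` and `gromovProd`: the projection to
Gromov's tree shortens a distance by exactly twice that gap. The heart of the proof is the bound
log₂(4n+4)·δ for the gap on a δ-hyperbolic finite metric graph with β₁ ≤ n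
(`IsFiniteMetricGraph.gromovProdInf_le`).

Take a chain from x to y whose links have Gromov product at least c. Geodesics joining consecutive
members stay at height at least c above p, so the chain projects to a path in the graph on the
finite sphere of radius c whose adjacent points lie below a common point. A shortest such path is a
zigzag z₀ ≤ q₀ ≥ z₁ ≤ ... ≥ z_k; choose each peak q_i as low as possible. The loops p, z_i, q_i,
z_{i+1}, p are then independent in H₁: collapsing the complement of an open segment of the geodesic
from z_i to q_i gives a map to the circle, and the matrix of winding numbers is unitriangular. Hence
k ≤ n (`le_firstBetti_of_zigzag`). The zigzag is a chain of 2k+2 links, and repeated halving costs δ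
for each doubling of length. For n = 0 there is no peak and the gap vanishes, so metric trees are
0-hyperbolic.

Stability does the rest. A correspondence of distortion r changes both products by at most 3r/2 and
the hyperbolicity by at most 2r. Gromov's tree of a compact geodesic space is a limit of finite
metric trees (`exists_tree_hasCorr`), so any comparison with it bounds `graphDelta X 0`. -/

theorem firstBetti_eq_zero_of_contractible (T : Type u) [TopologicalSpace T]
    [ContractibleSpace T] : firstBetti T = 0 := by
  obtain ⟨x, ⟨H⟩⟩ := id_nullhomotopic T
  let R := ModuleCat.of ℝ (ULift.{u} ℝ)
  let F := (singularHomologyFunctor (ModuleCat.{u} ℝ) 1).obj R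
  let a : TopCat.of T ⟶ TopCat.of PUnit.{u + 1} := TopCat.ofHom (ContinuousMap.const _ PUnit.unit)
  let b : TopCat.of PUnit.{u + 1} ⟶ TopCat.of T := TopCat.ofHom (ContinuousMap.const _ x)
  have hH : TopCat.Homotopy (𝟙 (TopCat.of T)) (a ≫ b) := H
  have h1 : F.map (𝟙 (TopCat.of T)) = F.map (a ≫ b) :=
    hH.congr_homologyMap_singularChainComplexFunctor R 1
  have h0 : IsZero (F.obj (TopCat.of PUnit.{u + 1})) :=
    isZero_singularHomologyFunctor_of_totallyDisconnectedSpace _ 1 R (TopCat.of PUnit.{u + 1})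
      one_ne_zero
  -- By homotopy invariance the identity of H₁(T) factors through H₁ of a point.
  have hz : IsZero (F.obj (TopCat.of T)) := by
    rw [IsZero.iff_id_eq_zero, ← F.map_id, h1, F.map_comp, h0.eq_of_tgt (F.map a) 0, zero_comp]
  have : Subsingleton (F.obj (TopCat.of T)) := ModuleCat.subsingleton_of_isZero hz
  have hr : Module.rank ℝ (F.obj (TopCat.of T)) = 0 := rank_subsingleton' _ _
  change Cardinal.toENat (Module.rank ℝ (F.obj (TopCat.of T))) = 0
  rw [hr]; simp

/-! ### Variation of the argument along paths in the circle -/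

/-- The total variation of the argument along a path in the circle. -/
def circleVar (c : C(I, AddCircle (1 : ℝ))) : ℝ :=
  (AddCircle.isCoveringMap_coe (1 : ℝ)).liftPath c (Quotient.out (c 0))
    (QuotientAddGroup.out_eq' (c 0)).symm 1 - Quotient.out (c 0)

/-- Two lifts differ by a constant, so the increment does not depend on the starting point chosen by
`Quotient.out`. -/
theorem circleVar_eq (c : C(I, AddCircle (1 : ℝ))) (Γ : C(I, ℝ))
    (h : ∀ t, (Γ t : AddCircle (1 : ℝ)) = c t) : circleVar c = Γ 1 - Γ 0 := by
  set e : ℝ := Quotient.out (c 0) with he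
  have hc : c 0 = (e : AddCircle (1 : ℝ)) := (QuotientAddGroup.out_eq' (c 0)).symm
  let Γ' : C(I, ℝ) := ⟨fun t => Γ t + (e - Γ 0), by fun_prop⟩
  have h0 : ((e - Γ 0 : ℝ) : AddCircle (1 : ℝ)) = 0 := by
    rw [AddCircle.coe_sub, h, hc, sub_self]
  have : Γ' = (AddCircle.isCoveringMap_coe (1 : ℝ)).liftPath c e hc := by
    rw [IsCoveringMap.eq_liftPath_iff']
    refine ⟨funext fun t => ?_, ?_⟩
    · simp only [Function.comp_apply, Γ', ContinuousMap.coe_mk, AddCircle.coe_add, h0, add_zero, h]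
    · simp [Γ']
  have h1 : circleVar c = Γ' 1 - e := by rw [this]; rfl
  rw [h1]; simp only [Γ', ContinuousMap.coe_mk]; ring

theorem exists_lift_circle (c : C(I, AddCircle (1 : ℝ))) :
    ∃ Γ : C(I, ℝ), ∀ t, (Γ t : AddCircle (1 : ℝ)) = c t := by
  obtain ⟨e, he⟩ := QuotientAddGroup.mk_surjective (c 0)
  obtain ⟨Γ, h, -⟩ := (AddCircle.isCoveringMap_coe (1 : ℝ)).exists_path_lifts c e he.symm
  exact ⟨Γ, fun t => congrFun h t⟩

/-! ### The linear functional on first homology given by a map to the circle -/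

/-- The standard parametrization of the `1`-simplex. -/
def simplexSeg : C(I, stdSimplex ℝ (Fin 2)) where
  toFun t := ⟨![1 - t, t], by
    refine ⟨fun i => ?_, by simp [Fin.sum_univ_two]⟩
    fin_cases i
    · simpa using t.2.2
    · simpa using t.2.1⟩
  continuous_toFun := by
    refine Continuous.subtype_mk (continuous_pi fun i => ?_) _
    fin_cases i <;> simp <;> fun_prop

/-- The square mapped onto the `2`-simplex, with one side collapsed to a vertex. -/
def simplexSquare : C(I × I, stdSimplex ℝ (Fin 3)) where
  toFun z := ⟨![1 - z.1, z.1 * (1 - z.2), z.1 * z.2], by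
    have h1 := z.1.2.1
    have h2 := z.1.2.2
    have h3 := z.2.2.1
    have h4 := z.2.2.2
    refine ⟨fun i => ?_, by simp [Fin.sum_univ_three]; ring⟩
    fin_cases i
    · simpa using h2
    · exact mul_nonneg h1 (by linarith)
    · exact mul_nonneg h1 h3⟩
  continuous_toFun := by
    refine Continuous.subtype_mk (continuous_pi fun i => ?_) _
    fin_cases i <;> simp <;> fun_prop

theorem stdSimplex_map_apply {m n : ℕ} (f : Fin m → Fin n) (s : stdSimplex ℝ (Fin m)) (i : Fin n) :
    (stdSimplex.map f s : Fin n → ℝ) i = ∑ j, if f j = i then s j else 0 := by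
  rw [stdSimplex.map_coe, FunOnFinite.linearMap_apply_apply, Finset.sum_filter]

theorem simplexSeg_face (t : I) :
    stdSimplex.map (Fin.succAbove (0 : Fin 3)) (simplexSeg t) = simplexSquare (1, t) ∧
    stdSimplex.map (Fin.succAbove (1 : Fin 3)) (simplexSeg t) = simplexSquare (t, 1) ∧
    stdSimplex.map (Fin.succAbove (2 : Fin 3)) (simplexSeg t) = simplexSquare (t, 0) := by
  have h0 : simplexSeg t 0 = 1 - t := rfl
  have h1 : simplexSeg t 1 = t := rfl
  have q0 (z : I × I) : simplexSquare z 0 = 1 - z.1 := rfl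
  have q1 (z : I × I) : simplexSquare z 1 = z.1 * (1 - z.2) := rfl
  have q2 (z : I × I) : simplexSquare z 2 = z.1 * z.2 := rfl
  refine ⟨?_, ?_, ?_⟩ <;> ext i <;> rw [stdSimplex_map_apply, Fin.sum_univ_two, h0, h1] <;>
    fin_cases i
  all_goals simp [q0, q1, q2, Fin.succAbove, ← Fin.val_inj]

/-! ### The winding cochain on singular simplices -/

variable {G : Type u} [TopologicalSpace G]

/-- The map lifts over the square, starting from a constant on the collapsed side. The three faces
are then lifted by the other sides of one map `F`, and the increments cancel. -/
theorem circleVar_cocycle (c : C(stdSimplex ℝ (Fin 3), AddCircle (1 : ℝ)))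
    (c₀ c₁ c₂ : C(I, AddCircle (1 : ℝ)))
    (h₀ : ∀ t, c₀ t = c (simplexSquare (1, t))) (h₁ : ∀ t, c₁ t = c (simplexSquare (t, 1)))
    (h₂ : ∀ t, c₂ t = c (simplexSquare (t, 0))) :
    circleVar c₀ - circleVar c₁ + circleVar c₂ = 0 := by
  obtain ⟨e, he⟩ := QuotientAddGroup.mk_surjective (c (simplexSquare (0, 0)))
  have hs : ∀ t : I, simplexSquare (0, t) = simplexSquare (0, 0) := fun t => by
    ext i; fin_cases i <;> simp [simplexSquare]
  let cov := AddCircle.isCoveringMap_coe (1 : ℝ)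
  have hH : ∀ a : I, (c.comp simplexSquare) (0, a) =
      ((ContinuousMap.const I e : C(I, ℝ)) a : AddCircle (1 : ℝ)) := fun a => by
    simp only [ContinuousMap.comp_apply, hs a, ContinuousMap.const_apply]; exact he.symm
  let F := cov.liftHomotopy (c.comp simplexSquare) (ContinuousMap.const I e) hH
  have hF : ∀ z, (F z : AddCircle (1 : ℝ)) = c (simplexSquare z) := fun z =>
    congrFun (cov.liftHomotopy_lifts (c.comp simplexSquare) (ContinuousMap.const I e) hH) z
  have hF0 : ∀ t, F (0, t) = e := fun t =>
    cov.liftHomotopy_zero (c.comp simplexSquare) (ContinuousMap.const I e) hH t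
  rw [circleVar_eq c₀ ⟨fun t => F (1, t), by fun_prop⟩ fun t => by
      rw [h₀]; exact hF _,
    circleVar_eq c₁ ⟨fun t => F (t, 1), by fun_prop⟩ fun t => by rw [h₁]; exact hF _,
    circleVar_eq c₂ ⟨fun t => F (t, 0), by fun_prop⟩ fun t => by rw [h₂]; exact hF _]
  simp only [ContinuousMap.coe_mk, hF0]
  ring

/-- The last barycentric coordinate on the `1`-simplex. -/
def simplexCoord : C(stdSimplex ℝ (Fin 2), I) where
  toFun s := ⟨s 1, s.2.1 1, stdSimplex.le_one s 1⟩
  continuous_toFun := by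
    refine Continuous.subtype_mk ?_ _
    exact (continuous_apply 1).comp continuous_subtype_val

/-- The continuous map underlying a singular simplex. -/
def simplexMap {n : ℕ} (τ : (TopCat.toSSet.obj (TopCat.of G)) _⦋n⦌) :
    C(stdSimplex ℝ (Fin (n + 1)), G) :=
  TopCat.toSSetObjEquiv (TopCat.of G) (.op ⦋n⦌) τ

/-- The singular `1`-simplex given by a path. -/
def pathSimplex (γ : C(I, G)) : (TopCat.toSSet.obj (TopCat.of G)) _⦋1⦌ :=
  (TopCat.toSSetObjEquiv (TopCat.of G) (.op ⦋1⦌)).symm (γ.comp simplexCoord)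

/-- The path underlying a singular `1`-simplex. -/
def simplexPath (τ : (TopCat.toSSet.obj (TopCat.of G)) _⦋1⦌) : C(I, G) :=
  (simplexMap τ).comp simplexSeg

theorem simplexMap_pathSimplex (γ : C(I, G)) :
    simplexMap (pathSimplex γ) = γ.comp simplexCoord :=
  (TopCat.toSSetObjEquiv (TopCat.of G) (.op ⦋1⦌)).apply_symm_apply _

theorem simplexPath_pathSimplex (γ : C(I, G)) : simplexPath (pathSimplex γ) = γ := by
  rw [simplexPath, simplexMap_pathSimplex]; rfl

theorem simplexMap_δ {n : ℕ} (τ : (TopCat.toSSet.obj (TopCat.of G)) _⦋n + 1⦌) (i : Fin (n + 2))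
    (s : stdSimplex ℝ (Fin (n + 1))) :
    simplexMap ((TopCat.toSSet.obj (TopCat.of G)).δ i τ) s =
      simplexMap τ (stdSimplex.map (Fin.succAbove i) s) :=
  rfl

theorem δ_pathSimplex_eq {γ : C(I, G)} (h : γ 0 = γ 1) :
    (TopCat.toSSet.obj (TopCat.of G)).δ (0 : Fin 2) (pathSimplex γ) =
      (TopCat.toSSet.obj (TopCat.of G)).δ (1 : Fin 2) (pathSimplex γ) := by
  refine (TopCat.toSSetObjEquiv (TopCat.of G) (.op ⦋0⦌)).injective
    (ContinuousMap.ext fun (s : stdSimplex ℝ (Fin 1)) => ?_)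
  refine (simplexMap_δ (pathSimplex γ) 0 s).trans
    (Eq.trans ?_ (simplexMap_δ (pathSimplex γ) 1 s).symm)
  rw [simplexMap_pathSimplex, ContinuousMap.comp_apply, ContinuousMap.comp_apply]
  have hs : s 0 = 1 := stdSimplex.eq_one_of_unique s 0
  have e0 : simplexCoord (stdSimplex.map (Fin.succAbove (0 : Fin 2)) s) = 1 :=
    Subtype.ext ((stdSimplex_map_apply _ s 1).trans (by
      rw [Fin.sum_univ_one, if_pos (by decide), hs]; rfl))
  have e1 : simplexCoord (stdSimplex.map (Fin.succAbove (1 : Fin 2)) s) = 0 :=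
    Subtype.ext ((stdSimplex_map_apply _ s 1).trans (by simp))
  rw [e0, e1, h]

/-- The total variation of the argument of `f` along a path. -/
def wind (f : C(G, AddCircle (1 : ℝ))) (γ : C(I, G)) : ℝ := circleVar (f.comp γ)

theorem wind_cocycle (f : C(G, AddCircle (1 : ℝ)))
    (τ : (TopCat.toSSet.obj (TopCat.of G)) _⦋2⦌) :
    wind f (simplexPath ((TopCat.toSSet.obj (TopCat.of G)).δ (0 : Fin 3) τ)) -
      wind f (simplexPath ((TopCat.toSSet.obj (TopCat.of G)).δ (1 : Fin 3) τ)) +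
      wind f (simplexPath ((TopCat.toSSet.obj (TopCat.of G)).δ (2 : Fin 3) τ)) = 0 := by
  refine circleVar_cocycle
    (f.comp (simplexMap τ)) _ _ _ (fun t => ?_) (fun t => ?_)
    (fun t => ?_)
  · rw [← (simplexSeg_face t).1]; exact congrArg f (simplexMap_δ τ 0 (simplexSeg t))
  · rw [← (simplexSeg_face t).2.1]; exact congrArg f (simplexMap_δ τ 1 (simplexSeg t))
  · rw [← (simplexSeg_face t).2.2]; exact congrArg f (simplexMap_δ τ 2 (simplexSeg t))

/-- The singular chain complex with real coefficients. -/
abbrev singChains (G : Type u) [TopologicalSpace G] : ChainComplex (ModuleCat.{u} ℝ) ℕ :=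
  (TopCat.toSSet.obj (TopCat.of G)).chainComplex (ModuleCat.of ℝ (ULift.{u} ℝ))

/-- The homology class of a loop. -/
def loopClass (γ : C(I, G)) (h : γ 0 = γ 1) :
    ModuleCat.of ℝ (ULift.{u} ℝ) ⟶ (singChains G).homology 1 :=
  (singChains G).liftCycles
    (SSet.ιChainComplex (X := TopCat.toSSet.obj (TopCat.of G))
      (R := ModuleCat.of ℝ (ULift.{u} ℝ)) (n := 1) (pathSimplex γ)) 0 (by simp)
    (by
      rw [SSet.ιChainComplex_d, Fin.sum_univ_two, δ_pathSimplex_eq h]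
      simp) ≫ (singChains G).homologyπ 1

/-- The cochain of a map to the circle. -/
def windCochain (f : C(G, AddCircle (1 : ℝ))) :
    (singChains G).X 1 ⟶ ModuleCat.of ℝ (ULift.{u} ℝ) :=
  Limits.Sigma.desc (f := fun _ : (TopCat.toSSet.obj (TopCat.of G)) _⦋1⦌ =>
    ModuleCat.of ℝ (ULift.{u} ℝ)) fun τ => wind f (simplexPath τ) • 𝟙 _

theorem ι_windCochain (f : C(G, AddCircle (1 : ℝ))) (τ : (TopCat.toSSet.obj (TopCat.of G)) _⦋1⦌) :
    SSet.ιChainComplex (X := TopCat.toSSet.obj (TopCat.of G)) τ ≫ windCochain f = wind f (simplexPath τ) • 𝟙 _ :=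
  Limits.Sigma.ι_desc _ _

/-- The linear functional on the first homology given by a map to the circle. -/
def windFunctional (f : C(G, AddCircle (1 : ℝ))) :
    (singChains G).homology 1 ⟶ ModuleCat.of ℝ (ULift.{u} ℝ) :=
  -- Homology embeds in chains modulo boundaries, to which a cocycle descends.
  (singChains G).homologyι 1 ≫ (singChains G).descOpcycles (windCochain f) 2 (by simp) (by
    refine SSet.chainComplex_hom_ext fun τ => ?_
    rw [SSet.ιChainComplex_d_assoc, Fin.sum_univ_three]
    simp only [Preadditive.add_comp, Preadditive.zsmul_comp, ι_windCochain, comp_zero]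
    have := wind_cocycle f τ
    rw [show wind f (simplexPath ((TopCat.toSSet.obj (TopCat.of G)).δ (1 : Fin 3) τ)) =
      wind f (simplexPath ((TopCat.toSSet.obj (TopCat.of G)).δ (0 : Fin 3) τ)) +
      wind f (simplexPath ((TopCat.toSSet.obj (TopCat.of G)).δ (2 : Fin 3) τ)) by linarith]
    simp [add_smul])

theorem loopClass_windFunctional (f : C(G, AddCircle (1 : ℝ))) (γ : C(I, G)) (h : γ 0 = γ 1) :
    loopClass γ h ≫ windFunctional f = wind f γ • 𝟙 _ := by
  rw [loopClass, windFunctional, Category.assoc, HomologicalComplex.homology_π_ι_assoc,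
    HomologicalComplex.liftCycles_i_assoc, HomologicalComplex.p_descOpcycles, ι_windCochain,
    simplexPath_pathSimplex]

/-- If finitely many loops and maps to the circle have a lower unitriangular matrix of winding
numbers, then there are at most `β₁` of them. -/
theorem le_firstBetti_of_wind (k : ℕ) (ℓ : Fin k → C(I, G)) (hℓ : ∀ j, ℓ j 0 = ℓ j 1)
    (f : Fin k → C(G, AddCircle (1 : ℝ))) (hdiag : ∀ i, wind (f i) (ℓ i) = 1)
    (hoff : ∀ i j, i < j → wind (f i) (ℓ j) = 0) : (k : ℕ∞) ≤ firstBetti G := by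
  let v : Fin k → (singChains G).homology 1 := fun j => (loopClass (ℓ j) (hℓ j)).hom ⟨1⟩
  have hv : ∀ i j, (windFunctional (f i)).hom (v j) =
      (ULift.moduleEquiv (R := ℝ)).symm (wind (f i) (ℓ j)) := fun i j => by
    have := congrArg (fun φ => φ.hom (⟨1⟩ : ULift ℝ))
      (loopClass_windFunctional (f i) (ℓ j) (hℓ j))
    simp only [ModuleCat.hom_comp, LinearMap.comp_apply] at this
    refine this.trans ?_
    ext
    simp
  have hli : LinearIndependent ℝ v := by
    rw [Fintype.linearIndependent_iff]
    intro a ha i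
    -- In the functional of `f i` applied to the relation, terms with j < i vanish by induction and
    -- those with j > i by `hoff`; only `a i` survives.
    induction i using WellFoundedLT.induction with
    | ind i ih =>
    have h1 := congrArg (fun w => ULift.moduleEquiv (R := ℝ) ((windFunctional (f i)).hom w)) ha
    simp only [map_sum, map_smul, hv, map_zero, LinearEquiv.apply_symm_apply, smul_eq_mul] at h1
    rw [Finset.sum_eq_single i] at h1
    · simpa [hdiag] using h1
    · intro j _ hj
      rcases lt_or_gt_of_ne hj with h | h
      · simp [ih j h]
      · simp [hoff i j h]
    · simp
  have h := hli.cardinal_lift_le_rank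
  have h2 : (k : Cardinal.{u}) ≤ Module.rank ℝ ((singChains G).homology 1) := by
    simpa using h
  have h3 : Cardinal.toENat (k : Cardinal.{u}) ≤ Cardinal.toENat _ := Cardinal.toENat.monotone' h2
  rwa [map_natCast] at h3

end Homology

/-! ### Geodesics in compact length spaces -/

/-- Two points of a length space are joined by almost geodesics, up to continuity. -/
theorem IsLengthSpace.exists_almost_geodesic {G : Type*} [MetricSpace G] (hG : IsLengthSpace G)
    (x y : G) {ε : ℝ} (hε : 0 < ε) :
    ∃ g : ℝ → G, ∀ s t, 0 ≤ s → s ≤ t → t ≤ dist x y →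
      dist x (g s) = s ∧ dist (g t) y ≤ dist x y - t + ε ∧
      t - s ≤ dist (g s) (g t) ∧ dist (g s) (g t) ≤ t - s + ε := by
  obtain ⟨γ, hγ⟩ : ∃ γ : Path x y, eVariationOn γ Set.univ < edist x y + ENNReal.ofReal ε := by
    rw [← iInf_lt_iff, ← hG x y]
    exact ENNReal.lt_add_right (edist_ne_top x y) (by simpa using hε)
  have hivt : ∀ b : I, ∀ t ∈ Set.Icc 0 (dist x (γ b)), ∃ τ ≤ b, dist x (γ τ) = t := by
    intro b t ht
    have h := intermediate_value_Icc (f := fun τ : I => dist x (γ τ)) (a := 0) (b := b) b.2.1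
      (by fun_prop)
    obtain ⟨τ, hτ, h1⟩ := h (by simpa using ht)
    exact ⟨τ, hτ.2, h1⟩
  -- The point at parameter t is the first one on the path at distance t from x; first hitting times
  -- are monotone in t.
  have hleast : ∀ t, 0 ≤ t → t ≤ dist x y → ∃ τ, IsLeast {τ : I | dist x (γ τ) = t} τ := by
    intro t h0 h1
    refine IsCompact.exists_isLeast (IsClosed.isCompact (isClosed_eq (by fun_prop) (by fun_prop))) ?_
    obtain ⟨τ, -, h⟩ := hivt 1 t (by simpa using ⟨h0, h1⟩)
    exact ⟨τ, h⟩
  choose! τ hτ using hleast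
  refine ⟨fun t => γ (τ t), fun s t hs hst ht => ?_⟩
  have h1 := hτ s hs (hst.trans ht)
  have h2 := hτ t (hs.trans hst) ht
  have d1 : dist x (γ (τ s)) = s := h1.1
  have d2 : dist x (γ (τ t)) = t := h2.1
  have hle : τ s ≤ τ t := by
    obtain ⟨τ', h3, h4⟩ := hivt (τ t) s (by rw [d2]; exact ⟨hs, hst⟩)
    exact (h1.2 h4).trans h3
  have hvar : edist x (γ (τ s)) + edist (γ (τ s)) (γ (τ t)) + edist (γ (τ t)) y ≤
      eVariationOn γ Set.univ := by
    have e1 := eVariationOn.Icc_add_Icc (γ : I → G) (s := Set.univ) (a := 0) (b := τ s) (c := τ t)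
      (τ s).2.1 hle trivial
    have e2 := eVariationOn.Icc_add_Icc (γ : I → G) (s := Set.univ) (a := 0) (b := τ t) (c := 1)
      (τ t).2.1 (τ t).2.2 trivial
    refine le_trans ?_ (eVariationOn.mono (γ : I → G) (Set.subset_univ (Set.univ ∩ Set.Icc 0 1)))
    rw [← e2, ← e1]
    gcongr
    · simpa using eVariationOn.edist_le (γ : I → G) (s := Set.univ ∩ Set.Icc 0 (τ s)) (x := 0)
        (y := τ s) ⟨trivial, le_rfl, (τ s).2.1⟩ ⟨trivial, (τ s).2.1, le_rfl⟩
    · exact eVariationOn.edist_le (γ : I → G) ⟨trivial, le_rfl, hle⟩ ⟨trivial, hle, le_rfl⟩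
    · simpa using eVariationOn.edist_le (γ : I → G) (s := Set.univ ∩ Set.Icc (τ t) 1) (x := τ t)
        (y := 1) ⟨trivial, le_rfl, (τ t).2.2⟩ ⟨trivial, (τ t).2.2, le_rfl⟩
  have hsum : dist x (γ (τ s)) + dist (γ (τ s)) (γ (τ t)) + dist (γ (τ t)) y ≤ dist x y + ε := by
    have := hvar.trans hγ.le
    simp only [edist_dist] at this
    rw [← ENNReal.ofReal_add (by positivity) (by positivity),
      ← ENNReal.ofReal_add (by positivity) (by positivity),
      ← ENNReal.ofReal_add (by positivity) (by positivity),
      ENNReal.ofReal_le_ofReal_iff (by positivity)] at this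
    exact this
  have t1 := dist_triangle x (γ (τ t)) y
  have t2 := dist_triangle x (γ (τ s)) (γ (τ t))
  have t3 : 0 ≤ dist (γ (τ s)) (γ (τ t)) := dist_nonneg
  have t4 := dist_triangle x (γ (τ s)) y
  have t5 := dist_triangle (γ (τ s)) (γ (τ t)) y
  refine ⟨d1, ?_, ?_, ?_⟩ <;> linarith

/-- Pointwise limits along one ultrafilter exist for all parameters at once, and the estimates for
almost geodesics pass to the limit, so continuity of the approximations is not needed. -/
theorem IsLengthSpace.isGeodesicSpace {G : Type*} [MetricSpace G] [CompactSpace G]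
    (hG : IsLengthSpace G) : IsGeodesicSpace G := by
  intro x y
  choose g hg using fun n : ℕ => hG.exists_almost_geodesic x y (Nat.one_div_pos_of_nat (n := n))
  have hlim : ∀ t, ∃ a, Tendsto (fun n => g n t) (hyperfilter ℕ : Filter ℕ) (𝓝 a) := fun t =>
    ⟨_, ((hyperfilter ℕ).map fun n => g n t).le_nhds_lim⟩
  choose γ hγ using hlim
  have hε : Tendsto (fun n : ℕ => 1 / ((n : ℝ) + 1)) (hyperfilter ℕ : Filter ℕ) (𝓝 0) :=
    tendsto_one_div_add_atTop_nhds_zero_nat.mono_left Nat.hyperfilter_le_atTop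
  have key : ∀ s t, 0 ≤ s → s ≤ t → t ≤ dist x y →
      dist x (γ s) = s ∧ dist (γ t) y ≤ dist x y - t ∧ dist (γ s) (γ t) = t - s := by
    intro s t hs hst ht
    refine ⟨?_, ?_, le_antisymm ?_ ?_⟩
    · exact tendsto_nhds_unique (tendsto_const_nhds.dist (hγ s))
        (by simp only [(hg _ s t hs hst ht).1]; exact tendsto_const_nhds)
    · have h := le_of_tendsto_of_tendsto' ((hγ t).dist (tendsto_const_nhds (x := y)))
        (tendsto_const_nhds.add hε) fun n => (hg n s t hs hst ht).2.1
      simpa using h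
    · have h := le_of_tendsto_of_tendsto' ((hγ s).dist (hγ t))
        (tendsto_const_nhds.add hε) fun n => (hg n s t hs hst ht).2.2.2
      simpa using h
    · exact ge_of_tendsto' ((hγ s).dist (hγ t)) fun n => (hg n s t hs hst ht).2.2.1
  refine ⟨γ, ?_, ?_, ?_⟩
  · have := (key 0 0 le_rfl le_rfl dist_nonneg).1
    exact (dist_eq_zero.1 this).symm
  · have := (key (dist x y) (dist x y) dist_nonneg le_rfl le_rfl).2.1
    exact dist_le_zero.1 (by simpa using this)
  · intro s hs t ht
    rcases le_total s t with h | h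
    · rw [(key s t hs.1 h ht.2).2.2, abs_sub_comm, abs_of_nonneg (by linarith)]
    · rw [dist_comm, (key t s ht.1 h hs.2).2.2, abs_of_nonneg (by linarith)]

/-- Constant speed geodesic paths. -/
theorem IsGeodesicSpace.exists_path {G : Type*} [MetricSpace G] (hG : IsGeodesicSpace G)
    (x y : G) : ∃ γ : Path x y, ∀ s t, dist (γ s) (γ t) = |(s : ℝ) - t| * dist x y := by
  obtain ⟨γ, h0, h1, h⟩ := hG x y
  have hmem : ∀ s : I, (s : ℝ) * dist x y ∈ Set.Icc 0 (dist x y) := fun s =>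
    ⟨mul_nonneg s.2.1 dist_nonneg, mul_le_of_le_one_left dist_nonneg s.2.2⟩
  have hd : ∀ s t : I, dist (γ (s * dist x y)) (γ (t * dist x y)) = |(s : ℝ) - t| * dist x y := by
    intro s t
    rw [h _ (hmem s) _ (hmem t), ← sub_mul, abs_mul, abs_of_nonneg (dist_nonneg (x := x))]
  refine ⟨⟨⟨fun s => γ (s * dist x y), ?_⟩, by simp [h0], by simp [h1]⟩, hd⟩
  refine (LipschitzWith.of_dist_le_mul (K := ⟨dist x y, dist_nonneg⟩) fun s t => ?_).continuous
  rw [hd, mul_comm]; rfl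

/-- A geodesic space is a length space. -/
theorem IsGeodesicSpace.isLengthSpace {G : Type*} [MetricSpace G] (hG : IsGeodesicSpace G) :
    IsLengthSpace G := by
  intro x y
  refine le_antisymm (le_iInf fun γ => ?_) ?_
  · simpa using eVariationOn.edist_le (γ : I → G) (s := Set.univ) (x := 0) (y := 1) trivial trivial
  · obtain ⟨γ, hγ⟩ := hG.exists_path x y
    refine iInf_le_of_le γ ?_
    have hφ : Monotone fun s : I => (s : ℝ) * dist x y := fun s t h =>
      mul_le_mul_of_nonneg_right h dist_nonneg
    have h1 : eVariationOn γ Set.univ = eVariationOn (fun s : I => (s : ℝ) * dist x y) Set.univ := by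
      simp only [eVariationOn]
      congr! 5 with P i
      rw [edist_dist, edist_dist, hγ, Real.dist_eq, ← sub_mul, abs_mul,
        abs_of_nonneg (dist_nonneg (x := x))]
    rw [h1]
    have h2 := (hφ.monotoneOn Set.univ).eVariationOn_eq (a := 0) (b := 1) trivial trivial
    have h3 : Set.univ ∩ Set.Icc (0 : I) 1 = Set.univ := by
      ext s; simp [s.2.2, Set.mem_Icc, ← Subtype.coe_le_coe]
    rw [h3] at h2
    refine h2.le.trans ?_
    rw [edist_dist]
    simp

/-! ### Edges of finite topological graphs -/

/-- An edge of a graph: its interior is embedded as an open subset. -/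
structure IsEdge {G : Type*} [TopologicalSpace G] (e : C(I, G)) : Prop where
  inj : ∀ s ∈ Set.Ioo (0 : I) 1, ∀ t, e s = e t → s = t
  isOpen : ∀ a b, IsOpen (e '' Set.Ioo a b)

theorem mem_Ioo_zero_one_or (t : I) : t = 0 ∨ t = 1 ∨ t ∈ Set.Ioo (0 : I) 1 := by
  rcases eq_or_ne t 0 with h | h
  · exact Or.inl h
  rcases eq_or_ne t 1 with h' | h'
  · exact Or.inr (Or.inl h')
  exact Or.inr (Or.inr ⟨unitInterval.pos_iff_ne_zero.2 h, unitInterval.lt_one_iff_ne_one.2 h'⟩)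

theorem Ioo_subset_Ioo_zero_one (a b : I) : Set.Ioo a b ⊆ Set.Ioo (0 : I) 1 :=
  Set.Ioo_subset_Ioo a.2.1 b.2.2

/-- The complement of an open subarc of an edge is closed: it is the union of the vertices, the
other edges and the rest of that edge, all compact and finite in number. -/
theorem IsFiniteTopologicalGraph.exists_edges {G : Type*} [TopologicalSpace G] [T2Space G]
    (hG : IsFiniteTopologicalGraph G) :
    ∃ (V : Set G) (m : ℕ) (e : Fin m → C(I, G)), V.Finite ∧ (∀ i, IsEdge (e i)) ∧
      ∀ x, x ∈ V ∨ ∃ i, ∃ s ∈ Set.Ioo (0 : I) 1, e i s = x := by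
  obtain ⟨V, m, e, hV, hend, hint, hinj, hcov⟩ := hG
  have hbd : ∀ i t, t ∉ Set.Ioo (0 : I) 1 → e i t ∈ V := fun i t ht => by
    rcases mem_Ioo_zero_one_or t with rfl | rfl | h
    exacts [(hend i).1, (hend i).2, absurd h ht]
  have hinj' : ∀ i j, ∀ s ∈ Set.Ioo (0 : I) 1, ∀ t, e i s = e j t → i = j ∧ s = t := by
    intro i j s hs t h
    by_cases ht : t ∈ Set.Ioo (0 : I) 1
    · exact hinj i j s hs t ht h
    · exact absurd (h ▸ hbd j t ht) (hint i s hs)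
  refine ⟨V, m, e, hV, fun i => ⟨fun s hs t h => (hinj' i i s hs t h).2, fun a b => ?_⟩,
    fun x => ?_⟩
  · have hc : (e i '' Set.Ioo a b)ᶜ =
        V ∪ (⋃ j ∈ {j | j ≠ i}, Set.range (e j)) ∪ e i '' (Set.Ioo a b)ᶜ := by
      ext x
      constructor
      · intro hx
        rcases hcov x with h | ⟨j, s, rfl⟩
        · exact Or.inl (Or.inl h)
        by_cases hj : j = i
        · subst hj
          exact Or.inr ⟨s, fun hs => hx ⟨s, hs, rfl⟩, rfl⟩
        · exact Or.inl (Or.inr (Set.mem_biUnion hj ⟨s, rfl⟩))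
      · rintro ((h | h) | ⟨t, ht, rfl⟩) ⟨s, hs, hsx⟩
        · exact hint i s (Ioo_subset_Ioo_zero_one a b hs) (hsx ▸ h)
        · obtain ⟨j, hj, t, rfl⟩ := Set.mem_iUnion₂.1 h
          exact hj (hinj' i j s (Ioo_subset_Ioo_zero_one a b hs) t hsx).1.symm
        · exact ht ((hinj' i i s (Ioo_subset_Ioo_zero_one a b hs) t hsx).2 ▸ hs)
    rw [← isClosed_compl_iff, hc]
    refine (hV.isClosed.union ?_).union
      (isOpen_Ioo.isClosed_compl.isCompact.image (e i).continuous).isClosed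
    exact (Set.toFinite _).isClosed_biUnion fun j _ => (isCompact_range (e j).continuous).isClosed
  · rcases hcov x with h | ⟨i, s, rfl⟩
    · exact Or.inl h
    · by_cases hs : s ∈ Set.Ioo (0 : I) 1
      exacts [Or.inr ⟨i, s, hs, rfl⟩, Or.inl (hbd i s hs)]

theorem IsFiniteTopologicalGraph.compactSpace {G : Type*} [TopologicalSpace G]
    (hG : IsFiniteTopologicalGraph G) : CompactSpace G := by
  obtain ⟨V, m, e, hV, -, -, -, hcov⟩ := hG
  refine ⟨?_⟩
  have : (Set.univ : Set G) = V ∪ ⋃ i, Set.range (e i) := by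
    ext x; simpa using hcov x
  rw [this]
  exact hV.isCompact.union (isCompact_iUnion fun i => isCompact_range (e i).continuous)

/-- A path entering an open set meets its boundary. -/
theorem exists_mem_of_isClosed_union {G : Type*} [TopologicalSpace G] {γ : I → G}
    (hγ : Continuous γ) {U F : Set G} (hU : IsOpen U) (hUF : IsClosed (U ∪ F)) {t₀ t₁ : I}
    (h₀ : γ t₀ ∈ U) (h₁ : γ t₁ ∉ U) : ∃ t ∈ Set.uIcc t₁ t₀, γ t ∈ F ∧ γ t ∉ U := by
  by_contra! hcon
  have hpre : IsPreconnected (γ '' Set.uIcc t₁ t₀) := isPreconnected_uIcc.image γ hγ.continuousOn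
  have hcover : γ '' Set.uIcc t₁ t₀ ⊆ U ∪ (U ∪ F)ᶜ := by
    rintro _ ⟨t, ht, rfl⟩
    by_cases h : γ t ∈ U
    · exact Or.inl h
    · exact Or.inr fun h' => h'.elim h fun h' => h (hcon t ht h')
  obtain ⟨_, -, h1, h2⟩ := hpre U (U ∪ F)ᶜ hU hUF.isOpen_compl hcover
    ⟨_, ⟨t₀, Set.right_mem_uIcc, rfl⟩, h₀⟩
    ⟨_, ⟨t₁, Set.left_mem_uIcc, rfl⟩, fun h => h.elim h₁ fun h => h₁ (hcon _ Set.left_mem_uIcc h)⟩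
  exact h2 (Or.inl h1)

theorem IsEdge.isClosed_union {G : Type*} [TopologicalSpace G] [T2Space G] {e : C(I, G)}
    {a b : I} (hab : a ≤ b) : IsClosed (e '' Set.Ioo a b ∪ {e a, e b}) := by
  have : e '' Set.Ioo a b ∪ {e a, e b} = e '' Set.Icc a b := by
    rw [← Set.image_pair, ← Set.image_union, Set.Ioo_union_both hab]
  rw [this]
  exact (isCompact_Icc.image e.continuous).isClosed

/-- Distance spheres in a finite metric graph are finite. -/
theorem IsFiniteTopologicalGraph.finite_sphere {G : Type*} [MetricSpace G]
    (hG : IsFiniteTopologicalGraph G) (hgeo : IsGeodesicSpace G) (p : G) (c : ℝ) :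
    {x | dist p x = c}.Finite := by
  obtain ⟨V, m, e, hV, he, hcov⟩ := hG.exists_edges
  by_cases hc : c = 0
  · subst hc
    refine (Set.finite_singleton p).subset fun x hx => ?_
    exact (dist_eq_zero.1 hx).symm
  -- If p lies outside the open arc, a geodesic from p to `e i b` enters it through an end, at
  -- distance c from p. But only the final point of the geodesic is that far.
  have key : ∀ i, ∀ a b t : I, a < b → b < t → dist p (e i a) = c → dist p (e i b) = c →
      dist p (e i t) = c → p ∈ e i '' Set.Ioo a t := by
    intro i a b t hab hbt ha hb ht
    by_contra hp
    obtain ⟨γ, hγ⟩ := hgeo.exists_path p (e i b)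
    obtain ⟨r, -, h1, h2⟩ := exists_mem_of_isClosed_union (γ := γ) γ.continuous
      ((he i).isOpen a t) (IsEdge.isClosed_union (hab.trans hbt).le) (t₀ := 1) (t₁ := 0)
      (by rw [γ.target]; exact ⟨b, ⟨hab, hbt⟩, rfl⟩) (by rwa [γ.source])
    have h3 : dist p (γ r) = c := by
      rcases h1 with h | h
      · rw [h, ha]
      · rw [h, ht]
    have h4 := hγ 0 r
    rw [γ.source, h3, hb] at h4
    have h5 : r = 1 := by
      have : (1 - (r : ℝ)) * c = 0 := by
        simp only [Set.Icc.coe_zero, zero_sub, abs_neg, abs_of_nonneg r.2.1] at h4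
        linarith
      rcases mul_eq_zero.1 this with h | h
      · exact Subtype.ext (by rw [Set.Icc.coe_one]; linarith)
      · exact absurd h hc
    rw [h5, γ.target] at h2
    exact h2 ⟨b, ⟨hab, hbt⟩, rfl⟩
  have hfin : ∀ i, {s ∈ Set.Ioo (0 : I) 1 | dist p (e i s) = c}.Finite := by
    intro i
    by_contra hinf
    -- Five points on one edge give two disjoint open arcs, both of which would contain p.
    obtain ⟨S, hS, hcard⟩ := Set.Infinite.exists_subset_card_eq hinf 5
    let f := S.orderEmbOfFin hcard
    have hf : ∀ k, dist p (e i (f k)) = c := fun k => (hS (S.orderEmbOfFin_mem hcard k)).2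
    obtain ⟨s, hs, hsp⟩ := key i (f 0) (f 1) (f 2) (f.strictMono (by decide))
      (f.strictMono (by decide)) (hf _) (hf _) (hf _)
    obtain ⟨t, ht, htp⟩ := key i (f 2) (f 3) (f 4) (f.strictMono (by decide))
      (f.strictMono (by decide)) (hf _) (hf _) (hf _)
    have := (he i).inj s (Ioo_subset_Ioo_zero_one _ _ hs) t (hsp.trans htp.symm)
    subst this
    exact lt_asymm hs.2 ht.1
  refine (hV.union (Set.finite_iUnion fun i => (hfin i).image (e i))).subset fun x hx => ?_
  rcases hcov x with h | ⟨i, s, hs, rfl⟩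
  · exact Or.inl h
  · exact Or.inr (Set.mem_iUnion.2 ⟨i, s, ⟨hs, hx⟩, rfl⟩)

/-- Geodesics in a finite metric graph contain a segment that is open in the graph. -/
theorem IsFiniteTopologicalGraph.exists_isOpen_image {G : Type*} [TopologicalSpace G] [T2Space G]
    (hG : IsFiniteTopologicalGraph G) {γ : I → G} (hγ : Continuous γ)
    (hinj : Function.Injective γ) : ∃ a b : I, a < b ∧ IsOpen (γ '' Set.Ioo a b) := by
  obtain ⟨V, m, e, hV, he, hcov⟩ := hG.exists_edges
  obtain ⟨t₀, ht₀, ht₀V⟩ : ∃ t ∈ Set.Ioo (0 : I) 1, γ t ∉ V := by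
    by_contra! h
    exact (Set.Ioo_infinite (zero_lt_one (α := I))) ((hV.preimage hinj.injOn).subset h)
  obtain ⟨i, s₀, hs₀, hes₀⟩ := (hcov (γ t₀)).resolve_left ht₀V
  -- The arc around `s₀` is kept away from both ends of γ, so γ must cross its boundary on each side
  -- of `t₀`.
  have hnhds : (e i) ⁻¹' {γ 0, γ 1}ᶜ ∩ Set.Ioo 0 1 ∈ 𝓝 s₀ := by
    refine inter_mem ((e i).continuous.continuousAt.preimage_mem_nhds ?_)
      (isOpen_Ioo.mem_nhds hs₀)
    refine (Set.toFinite {γ 0, γ 1}).isClosed.isOpen_compl.mem_nhds ?_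
    rw [hes₀]
    rintro (h | h)
    · exact ht₀.1.ne' (hinj h)
    · exact ht₀.2.ne (hinj h)
  obtain ⟨l, u, hlu, hsub⟩ := (mem_nhds_iff_exists_Ioo_subset' ⟨0, hs₀.1⟩ ⟨1, hs₀.2⟩).1 hnhds
  obtain ⟨s₁, hl1, h10⟩ := exists_between hlu.1
  obtain ⟨s₂, h02, h2u⟩ := exists_between hlu.2
  have hs₁ := (hsub ⟨hl1, h10.trans hlu.2⟩).2
  have hs₂ := (hsub ⟨hlu.1.trans h02, h2u⟩).2
  have hout : ∀ t : I, t = 0 ∨ t = 1 → γ t ∉ e i '' Set.Ioo s₁ s₂ := by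
    rintro t ht ⟨s, hs, h⟩
    have := (hsub ⟨hl1.trans hs.1, hs.2.trans h2u⟩).1
    rw [Set.mem_preimage, h] at this
    rcases ht with rfl | rfl <;> simp at this
  have h0U : γ t₀ ∈ e i '' Set.Ioo s₁ s₂ := ⟨s₀, ⟨h10, h02⟩, hes₀⟩
  have hop := (he i).isOpen s₁ s₂
  have hcl := IsEdge.isClosed_union (e := e i) (h10.trans h02).le
  obtain ⟨a, ha, haF, haU⟩ := exists_mem_of_isClosed_union hγ hop hcl h0U (hout 0 (Or.inl rfl))
  obtain ⟨b, hb, hbF, hbU⟩ := exists_mem_of_isClosed_union hγ hop hcl h0U (hout 1 (Or.inr rfl))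
  rw [Set.uIcc_of_le ht₀.1.le] at ha
  rw [Set.uIcc_of_ge ht₀.2.le] at hb
  have hat : a < t₀ := ha.2.lt_of_ne (by rintro rfl; exact haU h0U)
  have htb : t₀ < b := hb.1.lt_of_ne (by rintro rfl; exact hbU h0U)
  have hab := hat.trans htb
  -- the two ends of the edge segment are the two ends of the segment of the geodesic
  have hends : ∀ t, γ t ∈ ({e i s₁, e i s₂} : Set G) → t = a ∨ t = b := by
    have hne : γ a ≠ γ b := fun h => hab.ne (hinj h)
    intro t ht
    rcases haF with h1 | h1 <;> rcases hbF with h2 | h2 <;> rcases ht with h3 | h3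
    all_goals first
      | exact absurd (h1.trans h2.symm) hne
      | exact Or.inl (hinj (h3.trans h1.symm))
      | exact Or.inr (hinj (h3.trans h2.symm))
  have hsub1 : γ '' Set.Ioo a b ⊆ e i '' Set.Ioo s₁ s₂ := by
    rintro _ ⟨t, ht, rfl⟩
    by_contra hcon
    obtain ⟨r, hr, hrF, -⟩ := exists_mem_of_isClosed_union hγ hop hcl h0U hcon
    have h1 : a < r := (lt_min ht.1 hat).trans_le hr.1
    have h2 : r < b := hr.2.trans_lt (max_lt ht.2 htb)
    rcases hends r hrF with rfl | rfl
    exacts [h1.false, h2.false]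
  -- Going from `t₀` to `t₁`, γ leaves `U` through `e i s`, as wanted, or through `e i s'`. The
  -- latter is `γ t₂`, which by injectivity is attained only on the other side of `t₀`.
  have hcross : ∀ s s' : I, s ∈ Set.Ioo s₁ s₂ → ∀ t₁ t₂, (t₁ = a ∧ t₂ = b ∨ t₁ = b ∧ t₂ = a) →
      ∀ U, IsOpen U → IsClosed (U ∪ {e i s, e i s'}) → γ t₀ ∈ U → γ t₁ ∉ U → e i s' = γ t₂ →
      γ t₁ ≠ e i s → e i s ∈ γ '' Set.Ioo a b := by
    intro s s' hs t₁ t₂ ht U hU hUF h0 h1 hs' hne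
    obtain ⟨r, hr, hrF, hrU⟩ := exists_mem_of_isClosed_union hγ hU hUF h0 h1
    have hr0 : r ≠ t₀ := by rintro rfl; exact hrU h0
    rcases hrF with h | h
    · have hr1 : r ≠ t₁ := by rintro rfl; exact hne h
      refine ⟨r, ?_, h⟩
      rcases ht with ⟨rfl, rfl⟩ | ⟨rfl, rfl⟩
      · rw [Set.uIcc_of_le hat.le] at hr
        exact ⟨hr.1.lt_of_ne hr1.symm, hr.2.trans_lt htb⟩
      · rw [Set.uIcc_of_ge htb.le] at hr
        exact ⟨hat.trans_le hr.1, hr.2.lt_of_ne hr1⟩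
    · have hr2 : r = t₂ := hinj (h.trans hs')
      subst hr2
      rcases ht with ⟨rfl, rfl⟩ | ⟨rfl, rfl⟩
      · rw [Set.uIcc_of_le hat.le] at hr
        exact absurd hr.2 (not_le.2 htb)
      · rw [Set.uIcc_of_ge htb.le] at hr
        exact absurd hr.1 (not_le.2 hat)
  have hinjI := (he i).inj
  obtain ⟨t₁, t₂, ht, ht₁, ht₂⟩ : ∃ t₁ t₂, (t₁ = a ∧ t₂ = b ∨ t₁ = b ∧ t₂ = a) ∧
      γ t₁ = e i s₁ ∧ γ t₂ = e i s₂ := by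
    have hne : γ a ≠ γ b := fun h => hab.ne (hinj h)
    rcases haF with h1 | h1 <;> rcases hbF with h2 | h2
    · exact absurd (h1.trans h2.symm) hne
    · exact ⟨a, b, Or.inl ⟨rfl, rfl⟩, h1, h2⟩
    · exact ⟨b, a, Or.inr ⟨rfl, rfl⟩, h2, h1⟩
    · exact absurd (h1.trans h2.symm) hne
  have hsub2 : e i '' Set.Ioo s₁ s₂ ⊆ γ '' Set.Ioo a b := by
    rintro _ ⟨s, hs, rfl⟩
    rcases lt_trichotomy s s₀ with h | rfl | h
    · refine hcross s s₂ hs t₁ t₂ ht _ ((he i).isOpen s s₂) (IsEdge.isClosed_union hs.2.le)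
        ⟨s₀, ⟨h, h02⟩, hes₀⟩ ?_ ht₂.symm ?_
      · rw [ht₁]
        rintro ⟨r, hr, h'⟩
        exact (hs.1.trans hr.1).ne (hinjI s₁ hs₁ r h'.symm)
      · rw [ht₁]
        exact fun h' => hs.1.ne (hinjI s₁ hs₁ s h')
    · exact ⟨t₀, ⟨hat, htb⟩, hes₀.symm⟩
    · refine hcross s s₁ hs t₂ t₁ (ht.symm.imp And.symm And.symm) _ ((he i).isOpen s₁ s)
        (by rw [Set.pair_comm]; exact IsEdge.isClosed_union hs.1.le)
        ⟨s₀, ⟨h10, h⟩, hes₀⟩ ?_ ht₁.symm ?_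
      · rw [ht₂]
        rintro ⟨r, hr, h'⟩
        exact (hr.2.trans hs.2).ne' (hinjI s₂ hs₂ r h'.symm)
      · rw [ht₂]
        exact fun h' => hs.2.ne' (hinjI s₂ hs₂ s h')
  exact ⟨a, b, hab, (hsub1.antisymm hsub2) ▸ hop⟩

/-! ### Winding numbers of paths -/

theorem wind_eq_zero {G : Type*} [TopologicalSpace G] (f : C(G, AddCircle (1 : ℝ))) (γ : C(I, G))
    (h : ∀ t, f (γ t) = 0) : wind f γ = 0 := by
  rw [wind, circleVar_eq _ (ContinuousMap.const I 0) fun t => by simp [h]]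
  simp

/-- After a shift by a period, the lift of the second path continues that of the first. -/
theorem wind_trans {G : Type*} [TopologicalSpace G] (f : C(G, AddCircle (1 : ℝ))) {x y z : G}
    (γ : Path x y) (γ' : Path y z) :
    wind f (γ.trans γ').toContinuousMap = wind f γ.toContinuousMap + wind f γ'.toContinuousMap := by
  obtain ⟨Γ, hΓ⟩ := exists_lift_circle (f.comp γ.toContinuousMap)
  obtain ⟨Γ', hΓ'⟩ := exists_lift_circle (f.comp γ'.toContinuousMap)
  have hΓ1 : ∀ t, (Γ t : AddCircle (1 : ℝ)) = f (γ t) := hΓ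
  have hΓ1' : ∀ t, (Γ' t : AddCircle (1 : ℝ)) = f (γ' t) := hΓ'
  let P : Path (Γ 0) (Γ 1) := ⟨Γ, rfl, rfl⟩
  let P' : Path (Γ 1) (Γ 1 + (Γ' 1 - Γ' 0)) :=
    ⟨⟨fun t => Γ 1 + (Γ' t - Γ' 0), by fun_prop⟩, by simp, by simp⟩
  have h0 : ((Γ 1 - Γ' 0 : ℝ) : AddCircle (1 : ℝ)) = 0 := by
    rw [AddCircle.coe_sub, hΓ1, hΓ1']; simp
  rw [wind, wind, wind, circleVar_eq _ Γ hΓ, circleVar_eq _ Γ' hΓ',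
    circleVar_eq _ (P.trans P').toContinuousMap]
  · change (P.trans P') 1 - (P.trans P') 0 = _
    rw [Path.target, Path.source]; ring
  · intro t
    change (((P.trans P') t : ℝ) : AddCircle (1 : ℝ)) = f ((γ.trans γ') t)
    rw [Path.trans_apply, Path.trans_apply]
    split_ifs with ht
    · exact hΓ1 _
    · change ((Γ 1 + (Γ' _ - Γ' 0) : ℝ) : AddCircle (1 : ℝ)) = _
      rw [show ∀ r : ℝ, Γ 1 + (r - Γ' 0) = r + (Γ 1 - Γ' 0) from fun r => by ring,
        AddCircle.coe_add, h0, add_zero, hΓ1']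

/-- Given a geodesic in a finite graph, there is a map from the graph to the circle which is
trivial off the interior of the geodesic and has winding number one along the geodesic. -/
theorem IsFiniteTopologicalGraph.exists_wind_eq_one {G : Type*} [MetricSpace G]
    (hG : IsFiniteTopologicalGraph G) {x y : G} (hxy : x ≠ y) (γ : Path x y)
    (hγ : ∀ s t, dist (γ s) (γ t) = |(s : ℝ) - t| * dist x y) :
    ∃ f : C(G, AddCircle (1 : ℝ)), (∀ u, u ∉ γ '' Set.Ioo 0 1 → f u = 0) ∧
      wind f γ.toContinuousMap = 1 := by
  have hL : 0 < dist x y := dist_pos.2 hxy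
  have hinj : Function.Injective γ := fun s t h => by
    have := hγ s t
    rw [h, dist_self, eq_comm, mul_eq_zero] at this
    rcases this with h | h
    · exact Subtype.ext (sub_eq_zero.1 (abs_eq_zero.1 h))
    · exact absurd h hL.ne'
  obtain ⟨a, b, hab, hU⟩ := hG.exists_isOpen_image γ.continuous hinj
  have hab' : (0 : ℝ) < b - a := sub_pos.2 hab
  -- Along γ this rescaled distance from x runs from 0 to 1 over the open segment. Both end values
  -- are 0 in the circle, so it glues with the constant 0 outside.
  let φ : G → ℝ := fun u => (dist x u / dist x y - a) / (b - a)
  have hφc : Continuous φ := by fun_prop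
  have hφ : ∀ t : I, φ (γ t) = (t - a) / (b - a) := fun t => by
    have := hγ 0 t
    rw [γ.source] at this
    simp only [φ, this, Set.Icc.coe_zero, zero_sub, abs_neg, abs_of_nonneg t.2.1]
    rw [mul_div_assoc, div_self hL.ne', mul_one]
  have hfr : frontier (γ '' Set.Ioo a b) ⊆ {γ a, γ b} := by
    have h1 : closure (γ '' Set.Ioo a b) ⊆ γ '' Set.Icc a b :=
      closure_minimal (Set.image_mono Set.Ioo_subset_Icc_self)
        (isCompact_Icc.image γ.continuous).isClosed
    rw [hU.frontier_eq]
    rintro _ ⟨h2, h3⟩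
    obtain ⟨t, ht, rfl⟩ := h1 h2
    rcases eq_or_lt_of_le ht.1 with rfl | h4
    · exact Or.inl rfl
    rcases eq_or_lt_of_le ht.2 with rfl | h5
    · exact Or.inr rfl
    exact absurd ⟨t, ⟨h4, h5⟩, rfl⟩ h3
  classical
  let F : G → AddCircle (1 : ℝ) := fun u => if u ∈ γ '' Set.Ioo a b then (φ u : AddCircle (1 : ℝ)) else 0
  have hF : Continuous F := by
    refine Continuous.if (fun u hu => ?_) ((AddCircle.continuous_mk' 1).comp hφc) continuous_const
    rcases hfr hu with rfl | rfl
    · rw [hφ]; simp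
    · rw [hφ, div_self hab'.ne', AddCircle.coe_period]
  refine ⟨⟨F, hF⟩, fun u hu => ?_, ?_⟩
  · exact if_neg fun h => hu (Set.image_mono (Ioo_subset_Ioo_zero_one a b) h)
  · let Γ : C(I, ℝ) := ⟨fun t => max 0 (min 1 ((t - a) / (b - a))), by fun_prop⟩
    have hΓ : ∀ t, Γ t = max 0 (min 1 (((t : ℝ) - a) / (b - a))) := fun t => rfl
    rw [wind, circleVar_eq _ Γ]
    · have h1 : (1 : ℝ) ≤ (1 - a) / (b - a) := by
        rw [le_div_iff₀ hab']; linarith [b.2.2]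
      have h0 : (0 - (a : ℝ)) / (b - a) ≤ 0 :=
        div_nonpos_of_nonpos_of_nonneg (by linarith [a.2.1]) hab'.le
      rw [hΓ, hΓ, Set.Icc.coe_one, Set.Icc.coe_zero, min_eq_left h1,
        min_eq_right (h0.trans zero_le_one), max_eq_left h0]
      simp
    · intro t
      change (Γ t : AddCircle (1 : ℝ)) = F (γ t)
      rw [hΓ]
      by_cases ht : t ∈ Set.Ioo a b
      · have h1 : (t : ℝ) < b := ht.2
        have h2 : (a : ℝ) < t := ht.1
        rw [show F (γ t) = (φ (γ t) : AddCircle (1 : ℝ)) from if_pos ⟨t, ht, rfl⟩, hφ,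
          min_eq_right ((div_le_one hab').2 (by linarith)),
          max_eq_right (div_nonneg (by linarith) hab'.le)]
      · rw [show F (γ t) = 0 from if_neg fun ⟨s, hs, h⟩ => ht (hinj h ▸ hs)]
        rcases le_or_gt t a with h | h
        · have h' : (t : ℝ) ≤ a := h
          have h0 : ((t : ℝ) - a) / (b - a) ≤ 0 :=
            div_nonpos_of_nonpos_of_nonneg (by linarith) hab'.le
          rw [min_eq_right (h0.trans zero_le_one), max_eq_left h0]; simp
        · have h' : (b : ℝ) ≤ t := not_lt.1 fun h' => ht ⟨h, h'⟩
          rw [min_eq_left ((one_le_div hab').2 (by linarith)), max_eq_right zero_le_one,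
            AddCircle.coe_period]

/-! ### Counting the peaks of a zigzag -/

/-- `z` lies on a geodesic from `p` to `u`. -/
def Below {G : Type*} [MetricSpace G] (p z u : G) : Prop := dist p u = dist p z + dist z u

theorem Below.trans {G : Type*} [MetricSpace G] {p x y z : G} (h₁ : Below p x y)
    (h₂ : Below p y z) : Below p x z := by
  have h3 := dist_triangle x y z
  have h4 := dist_triangle p x z
  unfold Below at *
  linarith

theorem isClosed_setOf_below {G : Type*} [MetricSpace G] (p z : G) : IsClosed {u | Below p z u} :=
  isClosed_eq (by fun_prop) (by fun_prop)

theorem below_geodesic {G : Type*} [MetricSpace G] {p z u : G} (h : Below p z u) {γ : Path z u}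
    (hγ : ∀ s t, dist (γ s) (γ t) = |(s : ℝ) - t| * dist z u) (t : I) :
    Below p z (γ t) ∧ Below p (γ t) u ∧ dist p (γ t) = dist p z + t * dist z u := by
  have h1 := hγ 0 t
  have h2 := hγ t 1
  have ht := t.2.2
  rw [γ.source, Set.Icc.coe_zero, zero_sub, abs_neg, abs_of_nonneg t.2.1] at h1
  rw [γ.target, Set.Icc.coe_one, abs_sub_comm, abs_of_nonneg (by linarith)] at h2
  have h3 := dist_triangle p z (γ t)
  have h4 := dist_triangle p (γ t) u
  unfold Below at *
  refine ⟨?_, ?_, ?_⟩ <;> linarith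

/-- A zigzag `z₀ ≤ q₀ ≥ z₁ ≤ q₁ ≥ ... ≥ z_k` without shortcuts, and with lowest peaks, forces
the first Betti number to be at least `k`. -/
theorem le_firstBetti_of_zigzag {G : Type*} [MetricSpace G]
    (hG : IsFiniteTopologicalGraph G) (hgeo : IsGeodesicSpace G) (p : G) (c : ℝ) (k : ℕ)
    (z q : ℕ → G) (hz : ∀ i ≤ k, dist p (z i) = c)
    (h₁ : ∀ i < k, Below p (z i) (q i)) (h₂ : ∀ i < k, Below p (z (i + 1)) (q i))
    (hne : ∀ i < k, z i ≠ z (i + 1)) (hsep : ∀ i j, i < j → j < k → ¬ Below p (z i) (q j))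
    (hmin : ∀ i < k, ∀ u, Below p (z i) u → Below p (z (i + 1)) u → dist p (q i) ≤ dist p u) :
    (k : ℕ∞) ≤ firstBetti G := by
  choose α hα using fun i => hgeo.exists_path p (z i)
  choose up hup using fun i => hgeo.exists_path (z i) (q i)
  choose dn hdn using fun i => hgeo.exists_path (z (i + 1)) (q i)
  have hzq : ∀ i < k, z i ≠ q i := fun i hi h => by
    have e1 := h₂ i hi
    have e2 := hz i hi.le
    have e3 := hz (i + 1) hi
    have e4 : 0 < dist (z (i + 1)) (q i) := dist_pos.2 (h ▸ (hne i hi).symm)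
    rw [Below, ← h] at e1
    rw [← h] at e4
    linarith
  choose! f hf0 hf1 using fun i (hi : i < k) =>
    hG.exists_wind_eq_one (hzq i hi) (up i) (hup i)
  have hbelow : ∀ i < k, ∀ u ∈ up i '' Set.Ioo 0 1,
      Below p (z i) u ∧ c < dist p u ∧ dist p u < dist p (q i) := by
    rintro i hi _ ⟨t, ht, rfl⟩
    obtain ⟨e1, -, e2⟩ := below_geodesic (h₁ i hi) (hup i) t
    have e3 := hz i hi.le
    have e4 : 0 < dist (z i) (q i) := dist_pos.2 (hzq i hi)
    have e5 : dist p (q i) = dist p (z i) + dist (z i) (q i) := h₁ i hi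
    have e6 : (0 : ℝ) < t := ht.1
    have e7 : (t : ℝ) < 1 := ht.2
    refine ⟨e1, ?_, ?_⟩ <;> nlinarith
  -- The legs to p stay within height c, while `f i` is supported strictly above it.
  have hfα : ∀ i < k, ∀ j ≤ k, ∀ t, f i (α j t) = 0 := by
    refine fun i hi j hj t => hf0 i hi _ fun h => ?_
    have e1 := (hbelow i hi _ h).2.1
    have e2 := hα j 0 t
    rw [(α j).source, Set.Icc.coe_zero, zero_sub, abs_neg, abs_of_nonneg t.2.1, hz j hj] at e2
    have e3 := hz j hj
    have e4 : 0 ≤ c := e3 ▸ dist_nonneg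
    have e5 : dist p (α j t) ≤ c := by rw [e2]; exact mul_le_of_le_one_left e4 t.2.2
    exact absurd e1 (not_lt.2 e5)
  -- A meeting with the interior of `up i` would put `z i` below `q j`, which is a shortcut.
  have hup0 : ∀ i j, i < j → j < k → wind (f i) (up j).toContinuousMap = 0 := by
    refine fun i j hij hj => wind_eq_zero _ _ fun t => hf0 i (hij.trans hj) _ fun h => ?_
    exact hsep i j hij hj ((hbelow i (hij.trans hj) _ h).1.trans
      (below_geodesic (h₁ j hj) (hup j) t).2.1)
  -- For i < j this is again a shortcut. For i = j a meeting point would be a common upper bound of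
  -- `z i` and `z (i + 1)` lower than `q i`.
  have hdn0 : ∀ i j, i ≤ j → j < k → wind (f i) (dn j).symm.toContinuousMap = 0 := by
    refine fun i j hij hj => wind_eq_zero _ _ fun t => hf0 i (hij.trans_lt hj) _ fun h => ?_
    have e1 := hbelow i (hij.trans_lt hj) _ h
    have e2 := below_geodesic (h₂ j hj) (hdn j) (σ t)
    rcases hij.lt_or_eq with h3 | rfl
    · exact hsep i j h3 hj (e1.1.trans e2.2.1)
    · exact absurd (hmin i hj _ e1.1 e2.1) (not_le.2 e1.2.2)
  have hα0 : ∀ i < k, ∀ j ≤ k, wind (f i) (α j).toContinuousMap = 0 := fun i hi j hj =>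
    wind_eq_zero _ _ (hfα i hi j hj)
  have hback0 : ∀ i < k, ∀ j ≤ k, wind (f i) (α j).symm.toContinuousMap = 0 := fun i hi j hj =>
    wind_eq_zero _ _ fun t => hfα i hi j hj (σ t)
  let ℓ : Fin k → C(I, G) := fun j =>
    ((((α j).trans (up j)).trans (dn j).symm).trans (α (j + 1)).symm).toContinuousMap
  have hℓ : ∀ i j : Fin k, wind (f i) (ℓ j) = wind (f i) (up j).toContinuousMap +
      wind (f i) (dn j).symm.toContinuousMap := fun i j => by
    simp only [ℓ, wind_trans]
    rw [hα0 i i.2 j j.2.le, hback0 i i.2 (j + 1) j.2]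
    ring
  refine le_firstBetti_of_wind k ℓ (fun j => ?_) (fun i => f i) (fun i => ?_) (fun i j hij => ?_)
  · have e (P : Path p p) : P.toContinuousMap 0 = P.toContinuousMap 1 :=
      P.source.trans P.target.symm
    exact e _
  · rw [hℓ, hf1 i i.2, hdn0 i i le_rfl i.2, add_zero]
  · rw [hℓ, hup0 i j hij j.2, hdn0 i j (le_of_lt hij) j.2, add_zero]

/-! ### Gromov products, level graphs and zigzags -/

theorem gromovProd_nonneg {X : Type*} [MetricSpace X] (p x y : X) : 0 ≤ gromovProd p x y := by
  have := dist_triangle_left x y p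
  simp only [gromovProd]; linarith

theorem gromovProd_le_right {X : Type*} [MetricSpace X] (p x y : X) :
    gromovProd p x y ≤ dist p y :=
  gromovProd_comm p x y ▸ gromovProd_le_left p y x

theorem gromovProd_le_gromovProdInf {X : Type*} [MetricSpace X] (p x y : X) :
    gromovProd p x y ≤ gromovProdInf p x y :=
  le_csSup (chain_bddAbove p x y)
    ⟨0, fun i => if i = 0 then x else y, by simp, by simp, by simp [chainMin]⟩

theorem gromovProd_eq_of_below {X : Type*} [MetricSpace X] {p z u : X} (h : Below p z u) :
    gromovProd p z u = dist p z := by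
  unfold Below at h
  simp only [gromovProd]; linarith

theorem gromovProd_le_dist {X : Type*} [MetricSpace X] (p : X) {x y w : X}
    (h : dist x y = dist x w + dist w y) : gromovProd p x y ≤ dist p w := by
  have h1 := dist_triangle_right p x w
  have h2 := dist_triangle p w y
  simp only [gromovProd]; linarith

theorem le_gromovProd_of_below {X : Type*} [MetricSpace X] {p z x y : X} (hx : Below p z x)
    (hy : Below p z y) : dist p z ≤ gromovProd p x y := by
  have := dist_triangle_left x y z
  unfold Below at hx hy
  simp only [gromovProd]; linarith

theorem exists_below {G : Type*} [MetricSpace G] (hgeo : IsGeodesicSpace G) (p u : G) {c : ℝ}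
    (hc : 0 ≤ c) (hcu : c ≤ dist p u) : ∃ z, dist p z = c ∧ Below p z u := by
  obtain ⟨γ, h0, h1, h⟩ := hgeo p u
  have e1 := h 0 ⟨le_rfl, dist_nonneg⟩ c ⟨hc, hcu⟩
  have e2 := h c ⟨hc, hcu⟩ (dist p u) ⟨dist_nonneg, le_rfl⟩
  rw [h0, zero_sub, abs_neg, abs_of_nonneg hc] at e1
  rw [h1, abs_sub_comm, abs_of_nonneg (by linarith)] at e2
  exact ⟨γ c, e1, by rw [Below, e1, e2]; ring⟩

/-- The graph on a distance sphere in which two points are adjacent if they lie below a common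
point. -/
def levelGraph {G : Type*} [MetricSpace G] (p : G) (c : ℝ) : SimpleGraph {z : G // dist p z = c} where
  Adj z z' := z ≠ z' ∧ ∃ q, Below p z q ∧ Below p z' q
  symm := ⟨fun _ _ ⟨h, q, h1, h2⟩ => ⟨h.symm, q, h2, h1⟩⟩
  loopless := ⟨fun _ h => h.1 rfl⟩

theorem levelGraph_reachable_of_below {G : Type*} [MetricSpace G] {p q : G} {c : ℝ}
    {z z' : {z : G // dist p z = c}} (h : Below p z q) (h' : Below p z' q) :
    (levelGraph p c).Reachable z z' := by
  by_cases hz : z = z'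
  · rw [hz]
  · exact SimpleGraph.Adj.reachable ⟨hz, q, h, h'⟩

/-- Each point of a geodesic from u to v has height at least c, hence a level point below it. As the
sphere is finite, the parameters with such a point in the component of z form a closed set, as do
those with one outside. By connectedness some parameter lies in both, and its two level points are
adjacent or equal. -/
theorem levelGraph_reachable_of_gromovProd {G : Type*} [MetricSpace G]
    (hG : IsFiniteTopologicalGraph G) (hgeo : IsGeodesicSpace G) {p u v : G} {c : ℝ} (hc : 0 ≤ c)
    (huv : c ≤ gromovProd p u v) {z z' : {z : G // dist p z = c}} (hz : Below p z u)
    (hz' : Below p z' v) : (levelGraph p c).Reachable z z' := by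
  have : Finite {z : G // dist p z = c} := (hG.finite_sphere hgeo p c).to_subtype
  obtain ⟨γ, hγ⟩ := hgeo.exists_path u v
  have hcl : ∀ S : Set {z : G // dist p z = c}, IsClosed {t : I | ∃ w ∈ S, Below p w (γ t)} := by
    intro S
    have : {t : I | ∃ w ∈ S, Below p w (γ t)} = ⋃ w ∈ S, γ ⁻¹' {x | Below p w x} := by
      ext t; simp
    rw [this]
    exact S.toFinite.isClosed_biUnion fun w _ => (isClosed_setOf_below p w.1).preimage γ.continuous
  have hex : ∀ t, ∃ w : {z : G // dist p z = c}, Below p w (γ t) := by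
    intro t
    have h1 := hγ 0 t
    have h2 := hγ t 1
    have ht := t.2.2
    rw [γ.source, Set.Icc.coe_zero, zero_sub, abs_neg, abs_of_nonneg t.2.1] at h1
    rw [γ.target, Set.Icc.coe_one, abs_sub_comm, abs_of_nonneg (by linarith)] at h2
    obtain ⟨w, hw, hw'⟩ := exists_below hgeo p (γ t) hc
      (huv.trans (gromovProd_le_dist p (by rw [h1, h2]; ring)))
    exact ⟨⟨w, hw⟩, hw'⟩
  have hpre : IsPreconnected (Set.univ : Set I) := isPreconnected_univ
  rw [isPreconnected_closed_iff] at hpre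
  by_contra hcon
  obtain ⟨t, -, ⟨w, hw, hwt⟩, w', hw', hwt'⟩ := hpre _ _
    (hcl {w | (levelGraph p c).Reachable z w}) (hcl {w | ¬ (levelGraph p c).Reachable z w})
    (fun t _ => by
      obtain ⟨w, hw⟩ := hex t
      by_cases h : (levelGraph p c).Reachable z w
      · exact Or.inl ⟨w, h, hw⟩
      · exact Or.inr ⟨w, h, hw⟩)
    ⟨0, trivial, z, SimpleGraph.Reachable.refl _, by rwa [γ.source]⟩
    ⟨1, trivial, z', hcon, by rwa [γ.target]⟩
  exact hw' (hw.trans (levelGraph_reachable_of_below hwt hwt'))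

theorem levelGraph_reachable_of_chain {G : Type*} [MetricSpace G]
    (hG : IsFiniteTopologicalGraph G) (hgeo : IsGeodesicSpace G) {p : G} {c : ℝ} (hc : 0 ≤ c)
    (s : ℕ → G) (n : ℕ) (hs : ∀ i ≤ n, c ≤ gromovProd p (s i) (s (i + 1)))
    {z z' : {z : G // dist p z = c}} (hz : Below p z (s 0)) (hz' : Below p z' (s (n + 1))) :
    (levelGraph p c).Reachable z z' := by
  induction n generalizing z' with
  | zero => exact levelGraph_reachable_of_gromovProd hG hgeo hc (hs 0 le_rfl) hz hz'
  | succ n ih =>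
    obtain ⟨w, hw, hw'⟩ := exists_below hgeo p (s (n + 1)) hc
      ((hs (n + 1) le_rfl).trans (gromovProd_le_left _ _ _))
    exact (ih (fun i hi => hs i (by omega)) (z' := ⟨w, hw⟩) hw').trans
      (levelGraph_reachable_of_gromovProd hG hgeo hc (hs (n + 1) le_rfl) hw' hz')

theorem exists_lowest_upper_bound {G : Type*} [MetricSpace G] [CompactSpace G] {p z z' : G}
    (h : ∃ q, Below p z q ∧ Below p z' q) :
    ∃ q, Below p z q ∧ Below p z' q ∧
      ∀ u, Below p z u → Below p z' u → dist p q ≤ dist p u := by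
  have hc : IsCompact ({u | Below p z u} ∩ {u | Below p z' u}) :=
    ((isClosed_setOf_below p z).inter (isClosed_setOf_below p z')).isCompact
  obtain ⟨q, hq, hmin⟩ := hc.exists_isMinOn h (f := fun u => dist p u) (by fun_prop)
  exact ⟨q, hq.1, hq.2, fun u h1 h2 => hmin ⟨h1, h2⟩⟩

/-- In a finite metric graph with first Betti number at most `n`, two points on a distance sphere
in the same component of the level graph are joined by a zigzag with at most `n` peaks. -/
theorem exists_zigzag {G : Type*} [MetricSpace G] (hG : IsFiniteTopologicalGraph G)
    (hgeo : IsGeodesicSpace G) {n : ℕ} (hn : firstBetti G ≤ n) {p : G} {c : ℝ}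
    {z z' : {z : G // dist p z = c}} (h : (levelGraph p c).Reachable z z') :
    ∃ k ≤ n, ∃ s q : ℕ → G, s 0 = z ∧ s k = z' ∧ (∀ i, dist p (s i) = c) ∧
      ∀ i < k, Below p (s i) (q i) ∧ Below p (s (i + 1)) (q i) := by
  have := hG.compactSpace
  have : Nonempty G := ⟨p⟩
  obtain ⟨w, hw⟩ := h.exists_walk_length_eq_dist
  choose! q hq1 hq2 hq3 using fun i (hi : i < w.length) =>
    exists_lowest_upper_bound (w.adj_getVert_succ hi).2
  have hk : (w.length : ℕ∞) ≤ firstBetti G := by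
    refine le_firstBetti_of_zigzag hG hgeo p c w.length (fun i => w.getVert i) q
      (fun i _ => (w.getVert i).2) hq1 hq2
      (fun i hi h => (w.adj_getVert_succ hi).1 (Subtype.ext h)) (fun i j hij hj hb => ?_) hq3
    -- If the i-th vertex lay below `q j`, the walk could jump from it to vertex j+1 in at most one
    -- step, contradicting minimal length.
    obtain ⟨w', hw'⟩ : ∃ w' : (levelGraph p c).Walk (w.getVert i) (w.getVert (j + 1)),
        w'.length ≤ 1 := by
      by_cases he : w.getVert i = w.getVert (j + 1)
      · rw [he]; exact ⟨SimpleGraph.Walk.nil, by simp⟩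
      · have hadj : (levelGraph p c).Adj (w.getVert i) (w.getVert (j + 1)) :=
          ⟨he, q j, hb, hq2 j hj⟩
        exact ⟨hadj.toWalk, by simp⟩
    have h1 := SimpleGraph.dist_le (((w.take i).append w').append (w.drop (j + 1)))
    rw [SimpleGraph.Walk.length_append, SimpleGraph.Walk.length_append,
      SimpleGraph.Walk.take_length, SimpleGraph.Walk.drop_length, ← hw] at h1
    omega
  refine ⟨w.length, by exact_mod_cast hk.trans hn, fun i => w.getVert i, q, by simp, by simp,
    fun i => (w.getVert i).2, fun i hi => ⟨hq1 i hi, hq2 i hi⟩⟩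

/-! ### Gromov products along chains -/

theorem IsHyperbolic.min_gromovProd_le {X : Type*} [MetricSpace X] {δ : ℝ} (h : IsHyperbolic X δ)
    (p x y z : X) : min (gromovProd p x y) (gromovProd p y z) ≤ gromovProd p x z + δ := by
  have h1 := h p y x z
  simp only [gromovProd]
  rw [dist_comm y x] at h1
  rcases le_total (dist p x + dist y z) (dist p z + dist x y) with h2 | h2
  · rw [max_eq_right h2] at h1
    exact (min_le_left _ _).trans (by linarith)
  · rw [max_eq_left h2] at h1
    exact (min_le_right _ _).trans (by linarith)

/-- Splitting the chain at its midpoint costs one δ per doubling of the length. -/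
theorem IsHyperbolic.le_gromovProd_chain {X : Type*} [MetricSpace X] {δ : ℝ}
    (h : IsHyperbolic X δ) {p : X} {c : ℝ} (s : ℕ → X)
    (hs : ∀ i, c ≤ gromovProd p (s i) (s (i + 1))) (j i : ℕ) :
    c ≤ gromovProd p (s i) (s (i + 2 ^ j)) + j * δ := by
  induction j generalizing i with
  | zero => simpa using hs i
  | succ j ih =>
    have h1 := ih i
    have h2 := ih (i + 2 ^ j)
    have h3 := h.min_gromovProd_le p (s i) (s (i + 2 ^ j)) (s (i + 2 ^ j + 2 ^ j))
    rw [pow_succ, mul_two, ← add_assoc]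
    push_cast
    rcases min_le_iff.1 h3 with h4 | h4 <;> linarith

theorem exists_zigzag_of_chain {G : Type*} [MetricSpace G] (hG : IsFiniteMetricGraph G)
    {n : ℕ} (hn : firstBetti G ≤ n) (p : G) (m : ℕ) (s : ℕ → G) :
    ∃ k ≤ n, ∃ z q : ℕ → G, Below p (z 0) (s 0) ∧ Below p (z k) (s (m + 1)) ∧
      (∀ i, dist p (z i) = chainMin p m s) ∧
      ∀ i < k, Below p (z i) (q i) ∧ Below p (z (i + 1)) (q i) := by
  have hT := hG.isFiniteTopologicalGraph
  have := hT.compactSpace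
  have hgeo := hG.isLengthSpace.isGeodesicSpace
  have hc : 0 ≤ chainMin p m s := Finset.le_inf' _ _ fun i _ => gromovProd_nonneg _ _ _
  have hs : ∀ i ≤ m, chainMin p m s ≤ gromovProd p (s i) (s (i + 1)) := fun i hi =>
    Finset.inf'_le _ (Finset.mem_range.2 (by omega))
  obtain ⟨z, hz, hz'⟩ := exists_below hgeo p (s 0) hc (chainMin_le_left p m s)
  obtain ⟨w, hw, hw'⟩ := exists_below hgeo p (s (m + 1)) hc
    ((hs m le_rfl).trans (gromovProd_le_right _ _ _))
  obtain ⟨k, hk, r, q, h0, h1, h2, h3⟩ := exists_zigzag hT hgeo hn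
    (levelGraph_reachable_of_chain hT hgeo hc s m hs (z := ⟨z, hz⟩) (z' := ⟨w, hw⟩) hz' hw')
  exact ⟨k, hk, r, q, by rwa [h0], by rwa [h1], h2, h3⟩

/-- In a metric tree the Gromov product satisfies the ultrametric inequality. -/
theorem IsFiniteMetricGraph.gromovProdInf_le_of_firstBetti_eq_zero {G : Type*} [MetricSpace G]
    (hG : IsFiniteMetricGraph G) (h0 : firstBetti G ≤ (0 : ℕ)) (p x y : G) :
    gromovProdInf p x y ≤ gromovProd p x y := by
  refine csSup_le (chain_nonempty p x y) ?_
  rintro _ ⟨m, s, rfl, rfl, rfl⟩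
  obtain ⟨k, hk, z, q, h1, h2, h3, -⟩ := exists_zigzag_of_chain hG h0 p m s
  -- Without peaks, a single point of height c lies below both ends of the chain.
  obtain rfl : k = 0 := by omega
  rw [← h3 0]
  exact le_gromovProd_of_below h1 h2

theorem IsFiniteMetricGraph.gromovProdInf_le {G : Type*} [MetricSpace G]
    (hG : IsFiniteMetricGraph G) {n : ℕ} (hn : firstBetti G ≤ n) {δ : ℝ} (hδ : 0 ≤ δ)
    (h : IsHyperbolic G δ) (p x y : G) :
    gromovProdInf p x y ≤ gromovProd p x y + Real.logb 2 (4 * (n : ℝ) + 4) * δ := by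
  refine csSup_le (chain_nonempty p x y) ?_
  rintro _ ⟨m, s, rfl, rfl, rfl⟩
  obtain ⟨k, hk, z, q, h1, h2, h3, h4⟩ := exists_zigzag_of_chain hG hn p m s
  set c := chainMin p m s
  -- The chain x, z₀, q₀, z₁, ..., q_{k-1}, z_k, y has 2k+2 links; it is continued constantly so
  -- that its length may be rounded up to a power of two.
  let r : ℕ → G := fun i => if i = 0 then s 0 else if 2 * k + 2 ≤ i then s (m + 1) else
    if i % 2 = 1 then z (i / 2) else q (i / 2 - 1)
  have hr : ∀ i, c ≤ gromovProd p (r i) (r (i + 1)) := by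
    have hb : ∀ {i u}, Below p (z i) u → c ≤ gromovProd p (z i) u := fun {i u} hb => by
      rw [gromovProd_eq_of_below hb, h3]
    intro i
    have hr0 : r 0 = s 0 := rfl
    have hodd : ∀ j ≤ k, r (2 * j + 1) = z j := fun j hj => by
      simp only [r]
      rw [if_neg (by omega), if_neg (by omega), if_pos (by omega), show (2 * j + 1) / 2 = j by omega]
    have heven : ∀ j < k, r (2 * j + 2) = q j := fun j hj => by
      simp only [r]
      rw [if_neg (by omega), if_neg (by omega), if_neg (by omega),
        show (2 * j + 2) / 2 - 1 = j by omega]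
    have hend : ∀ j, 2 * k + 2 ≤ j → r j = s (m + 1) := fun j hj => by
      simp only [r]
      rw [if_neg (by omega), if_pos hj]
    rcases Nat.eq_zero_or_pos i with rfl | hi
    · rw [hr0, hodd 0 (Nat.zero_le k), gromovProd_comm]
      exact hb h1
    rcases le_or_gt (2 * k + 2) i with hi2 | hi2
    · rw [hend i hi2, hend (i + 1) (by omega)]
      have := hb h2
      refine this.trans ((gromovProd_le_right _ _ _).trans ?_)
      simp [gromovProd]
    obtain ⟨j, rfl | rfl⟩ : ∃ j, i = 2 * j + 1 ∨ i = 2 * j + 2 := ⟨(i - 1) / 2, by omega⟩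
    · rw [hodd j (by omega)]
      rcases (show j ≤ k by omega).lt_or_eq with hj | rfl
      · rw [heven j hj]; exact hb (h4 j hj).1
      · rw [hend _ le_rfl]; exact hb h2
    · rw [heven j (by omega), show 2 * j + 2 + 1 = 2 * (j + 1) + 1 by ring, hodd (j + 1) (by omega),
        gromovProd_comm]
      exact hb (h4 j (by omega)).2
  have hJ := h.le_gromovProd_chain r hr (Nat.clog 2 (2 * k + 2)) 0
  rw [zero_add, show r 0 = s 0 from rfl,
    show r (2 ^ Nat.clog 2 (2 * k + 2)) = s (m + 1) by
      have := Nat.le_pow_clog one_lt_two (2 * k + 2)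
      simp only [r]
      rw [if_neg (by positivity), if_pos this]] at hJ
  refine hJ.trans ?_
  gcongr
  -- The least power of two that is at least 2k+2 is below twice that number, hence at most 4n+4.
  rw [Real.le_logb_iff_rpow_le one_lt_two (by positivity), Real.rpow_natCast]
  have h5 := Nat.pow_pred_clog_lt_self one_lt_two (x := 2 * k + 2) (by omega)
  have h6 : Nat.clog 2 (2 * k + 2) = (Nat.clog 2 (2 * k + 2)).pred + 1 :=
    (Nat.succ_pred_eq_of_pos (Nat.clog_pos one_lt_two (by omega))).symm
  rw [h6, pow_succ]
  have h7 : 2 ^ (Nat.clog 2 (2 * k + 2)).pred * 2 ≤ 4 * n + 4 := by omega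
  exact_mod_cast h7

/-! ### Finite metric trees -/

/-- Heights and overlap heights of finitely many branches of a rooted tree. -/
structure TreeData where
  /-- the number of branches, minus one -/
  N : ℕ
  /-- the height at which two branches separate -/
  g : Fin (N + 1) → Fin (N + 1) → ℝ
  comm : ∀ i j, g i j = g j i
  nonneg : ∀ i j, 0 ≤ g i j
  ultra : ∀ i j k, min (g i j) (g j k) ≤ g i k

namespace TreeData

variable (T : TreeData)

/-- The diagonal entry is the length of a branch, so branches separate no higher than their tips. -/
theorem le_left (i j : Fin (T.N + 1)) : T.g i j ≤ T.g i i := by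
  have := T.ultra i j i
  rwa [T.comm j i, min_self] at this

/-- The disjoint union of the branches. -/
def Pre : Type := {a : Fin (T.N + 1) × ℝ // 0 ≤ a.2 ∧ a.2 ≤ T.g a.1 a.1}

/-- The height at which the branches of two points separate. -/
def meet (a b : T.Pre) : ℝ := min (min a.1.2 b.1.2) (T.g a.1.1 b.1.1)

theorem meet_le_left (a b : T.Pre) : T.meet a b ≤ a.1.2 := (min_le_left _ _).trans (min_le_left _ _)

theorem meet_comm (a b : T.Pre) : T.meet a b = T.meet b a := by
  rw [meet, meet, min_comm a.1.2, T.comm]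

theorem meet_self (a : T.Pre) : T.meet a a = a.1.2 := by
  rw [meet, min_self, min_eq_left a.2.2]

theorem min_meet_le (a b c : T.Pre) : min (T.meet a b) (T.meet b c) ≤ T.meet a c := by
  refine le_min (le_min ?_ ?_) ?_
  · exact (min_le_left _ _).trans (T.meet_le_left a b)
  · exact (min_le_right _ _).trans (T.meet_comm b c ▸ T.meet_le_left c b)
  · exact (min_le_min (min_le_right _ _) (min_le_right _ _)).trans (T.ultra _ _ _)

instance : PseudoMetricSpace T.Pre where
  dist a b := a.1.2 + b.1.2 - 2 * T.meet a b
  dist_self a := by rw [T.meet_self]; ring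
  dist_comm a b := by rw [T.meet_comm]; ring
  dist_triangle a b c := by
    have h := T.min_meet_le a b c
    have h1 := T.meet_le_left b a
    have h2 := T.meet_le_left b c
    rw [T.meet_comm] at h1
    rcases min_le_iff.1 h with h | h <;> linarith

/-- The metric tree obtained by gluing the branches. -/
abbrev Tree : Type := SeparationQuotient T.Pre

/-- The point at a given height on a branch. -/
def pt (i : Fin (T.N + 1)) (s : ℝ) : T.Tree :=
  SeparationQuotient.mk ⟨(i, max 0 (min s (T.g i i))), le_max_left _ _,
    max_le (T.nonneg i i) (min_le_right _ _)⟩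

variable {T}

theorem dist_pt {i j : Fin (T.N + 1)} {s t : ℝ} (hs : s ∈ Set.Icc 0 (T.g i i))
    (ht : t ∈ Set.Icc 0 (T.g j j)) :
    dist (T.pt i s) (T.pt j t) = s + t - 2 * min (min s t) (T.g i j) := by
  refine (SeparationQuotient.dist_mk _ _).trans ?_
  change max 0 (min s _) + max 0 (min t _) -
    2 * min (min (max 0 (min s _)) (max 0 (min t _))) (T.g i j) = _
  rw [min_eq_left hs.2, min_eq_left ht.2, max_eq_right hs.1, max_eq_right ht.1]

theorem dist_pt_self {i : Fin (T.N + 1)} {s t : ℝ} (hs : s ∈ Set.Icc 0 (T.g i i))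
    (ht : t ∈ Set.Icc 0 (T.g i i)) : dist (T.pt i s) (T.pt i t) = |s - t| := by
  rw [dist_pt hs ht, min_eq_left ((min_le_left _ _).trans hs.2)]
  rcases le_total s t with h | h
  · rw [min_eq_left h, abs_sub_comm, abs_of_nonneg (by linarith)]; ring
  · rw [min_eq_right h, abs_of_nonneg (by linarith)]; ring

theorem exists_pt (x : T.Tree) : ∃ i, ∃ s ∈ Set.Icc 0 (T.g i i), x = T.pt i s := by
  obtain ⟨⟨⟨i, s⟩, h0, h1⟩, rfl⟩ := SeparationQuotient.surjective_mk x
  refine ⟨i, s, ⟨h0, h1⟩, ?_⟩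
  simp only [pt]
  congr 3
  rw [min_eq_left h1, max_eq_right h0]

theorem pt_eq_pt {i j : Fin (T.N + 1)} {s t : ℝ} (hs : s ∈ Set.Icc 0 (T.g i i))
    (ht : t ∈ Set.Icc 0 (T.g j j)) : T.pt i s = T.pt j t ↔ s = t ∧ s ≤ T.g i j := by
  rw [← dist_eq_zero, dist_pt hs ht]
  constructor
  · intro h
    have h1 : min (min s t) (T.g i j) ≤ s := (min_le_left _ _).trans (min_le_left _ _)
    have h2 : min (min s t) (T.g i j) ≤ t := (min_le_left _ _).trans (min_le_right _ _)
    have h3 : min (min s t) (T.g i j) ≤ T.g i j := min_le_right _ _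
    exact ⟨by linarith, by linarith⟩
  · rintro ⟨rfl, h⟩
    rw [min_self, min_eq_left h]; ring

/-- The geodesic descends the first branch to the meeting height m and climbs the second. -/
theorem isGeodesicSpace : IsGeodesicSpace T.Tree := by
  intro x y
  obtain ⟨i, s, hs, rfl⟩ := exists_pt x
  obtain ⟨j, t, ht, rfl⟩ := exists_pt y
  rw [dist_pt hs ht]
  set m := min (min s t) (T.g i j) with hm
  have h1 : m ≤ s := (min_le_left _ _).trans (min_le_left _ _)
  have h2 : m ≤ t := (min_le_left _ _).trans (min_le_right _ _)
  have h3 : m ≤ T.g i j := min_le_right _ _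
  have h0 : 0 ≤ m := le_min (le_min hs.1 ht.1) (T.nonneg i j)
  have key : ∀ a ∈ Set.Icc m s, ∀ b ∈ Set.Icc m t,
      dist (T.pt i a) (T.pt j b) = (a - m) + (b - m) := by
    intro a ha b hb
    rw [dist_pt ⟨h0.trans ha.1, ha.2.trans hs.2⟩ ⟨h0.trans hb.1, hb.2.trans ht.2⟩]
    have : min (min a b) (T.g i j) = m :=
      le_antisymm (min_le_min (min_le_min ha.2 hb.2) le_rfl) (le_min (le_min ha.1 hb.1) h3)
    rw [this]; ring
  refine ⟨fun r => if r ≤ s - m then T.pt i (s - r) else T.pt j (t - (s + t - 2 * m - r)),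
    ?_, ?_, ?_⟩
  · simp only [if_pos (sub_nonneg.2 h1), sub_zero]
  · by_cases h : s + t - 2 * m ≤ s - m
    · simp only [if_pos h]
      rw [pt_eq_pt ⟨by linarith, by linarith [hs.2]⟩ ht]
      constructor <;> linarith
    · simp only [if_neg h, sub_self, sub_zero]
  · have hle : ∀ a b, 0 ≤ a → a ≤ b → b ≤ s + t - 2 * m →
        dist (if a ≤ s - m then T.pt i (s - a) else T.pt j (t - (s + t - 2 * m - a)))
          (if b ≤ s - m then T.pt i (s - b) else T.pt j (t - (s + t - 2 * m - b))) = b - a := by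
      intro a b ha hab hb
      by_cases hb1 : b ≤ s - m
      · rw [if_pos (hab.trans hb1), if_pos hb1, dist_pt_self ⟨by linarith, by linarith [hs.2]⟩
          ⟨by linarith, by linarith [hs.2]⟩, abs_of_nonneg (by linarith)]
        ring
      · by_cases ha1 : a ≤ s - m
        · rw [if_pos ha1, if_neg hb1, key _ ⟨by linarith, by linarith⟩ _ ⟨by linarith, by linarith⟩]
          ring
        · rw [if_neg ha1, if_neg hb1, dist_pt_self ⟨by linarith, by linarith [ht.2]⟩
            ⟨by linarith, by linarith [ht.2]⟩, abs_sub_comm, abs_of_nonneg (by linarith)]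
          ring
    intro a ha b hb
    rcases le_total a b with h | h
    · rw [hle a b ha.1 h hb.2, abs_sub_comm, abs_of_nonneg (by linarith)]
    · rw [dist_comm, hle b a hb.1 h ha.2, abs_of_nonneg (by linarith)]

/-- Cutting off a tree at a given height does not increase distances. -/
theorem dist_pt_min_le {i j : Fin (T.N + 1)} {s t L L' : ℝ} (hs : s ∈ Set.Icc 0 (T.g i i))
    (ht : t ∈ Set.Icc 0 (T.g j j)) (hL : 0 ≤ L) (hL' : 0 ≤ L') :
    dist (T.pt i (min s L)) (T.pt j (min t L')) ≤ dist (T.pt i s) (T.pt j t) + |L - L'| := by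
  have hmem : ∀ {k r M}, r ∈ Set.Icc 0 (T.g k k) → 0 ≤ M → min r M ∈ Set.Icc 0 (T.g k k) :=
    fun hr hM => ⟨le_min hr.1 hM, (min_le_left _ _).trans hr.2⟩
  -- Cut both points at the same height first, then change the height on one branch.
  refine (dist_triangle _ (T.pt j (min t L)) _).trans (add_le_add ?_ ?_)
  · rw [dist_pt hs ht, dist_pt (hmem hs hL) (hmem ht hL)]
    rcases le_total s L with h1 | h1 <;> rcases le_total t L with h2 | h2
    · rw [min_eq_left h1, min_eq_left h2]
    · rw [min_eq_left h1, min_eq_right h2, min_eq_left h1, min_eq_left (h1.trans h2)]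
      linarith
    · rw [min_eq_right h1, min_eq_left h2, min_eq_right h2, min_eq_right (h2.trans h1)]
      linarith
    · rw [min_eq_right h1, min_eq_right h2, min_self]
      rcases le_total L (T.g i j) with h3 | h3
      · rw [min_eq_left h3]
        have h4 : min (min s t) (T.g i j) ≤ s := (min_le_left _ _).trans (min_le_left _ _)
        have h5 : min (min s t) (T.g i j) ≤ t := (min_le_left _ _).trans (min_le_right _ _)
        linarith
      · rw [min_eq_right h3]
        have h4 : min (min s t) (T.g i j) ≤ T.g i j := min_le_right _ _
        linarith
  · rw [dist_pt_self (hmem ht hL) (hmem ht hL')]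
    simpa using abs_min_sub_min_le_max t L t L'

/-- Lowering the cut-off height from `M` to 0 retracts the tree to its root. Branch representatives
are chosen arbitrarily, but `dist_pt_min_le` makes the homotopy Lipschitz all the same. -/
theorem contractibleSpace : ContractibleSpace T.Tree := by
  rw [contractible_iff_id_nullhomotopic]
  choose i s hs hx using exists_pt (T := T)
  let M : ℝ := ∑ i, T.g i i
  have hM : ∀ i, T.g i i ≤ M := fun i =>
    Finset.single_le_sum (f := fun i => T.g i i) (fun j _ => T.nonneg j j) (Finset.mem_univ i)
  have hM0 : 0 ≤ M := (T.nonneg 0 0).trans (hM 0)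
  refine ⟨T.pt 0 0, ⟨⟨⟨fun z => T.pt (i z.2) (min (s z.2) ((1 - z.1) * M)), ?_⟩, fun x => ?_,
    fun x => ?_⟩⟩⟩
  · refine (LipschitzWith.of_dist_le_mul (K := ⟨1 + M, by positivity⟩) fun z w => ?_).continuous
    refine (dist_pt_min_le (hs _) (hs _) (mul_nonneg (sub_nonneg.2 z.1.2.2) hM0)
      (mul_nonneg (sub_nonneg.2 w.1.2.2) hM0)).trans ?_
    rw [← hx, ← hx]
    have h1 : dist z.2 w.2 ≤ dist z w := le_max_right _ _
    have h2 : dist z.1 w.1 ≤ dist z w := le_max_left _ _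
    have h3 : |(1 - (z.1 : ℝ)) * M - (1 - (w.1 : ℝ)) * M| = dist z.1 w.1 * M := by
      rw [← sub_mul, abs_mul, abs_of_nonneg hM0, Subtype.dist_eq, Real.dist_eq, abs_sub_comm]
      ring_nf
    rw [h3]
    change _ ≤ (1 + M) * dist z w
    nlinarith
  · change T.pt (i x) (min (s x) ((1 - ((0 : I) : ℝ)) * M)) = x
    rw [Set.Icc.coe_zero, sub_zero, one_mul, min_eq_left ((hs x).2.trans (hM _)), ← hx]
  · change T.pt (i x) (min (s x) ((1 - ((1 : I) : ℝ)) * M)) = T.pt 0 0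
    rw [Set.Icc.coe_one, sub_self, zero_mul, min_eq_right (hs x).1,
      pt_eq_pt ⟨le_rfl, T.nonneg _ _⟩ ⟨le_rfl, T.nonneg _ _⟩]
    exact ⟨rfl, T.nonneg _ _⟩

variable (T) in
/-- The heights of the vertices. -/
def levels : Finset ℝ := insert 0 (Finset.univ.image fun ij : Fin (T.N + 1) × Fin (T.N + 1) =>
  T.g ij.1 ij.2)

theorem mem_levels (i j : Fin (T.N + 1)) : T.g i j ∈ T.levels :=
  Finset.mem_insert_of_mem (Finset.mem_image.2 ⟨(i, j), Finset.mem_univ _, rfl⟩)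

theorem nonneg_of_mem_levels {l : ℝ} (hl : l ∈ T.levels) : 0 ≤ l := by
  rcases Finset.mem_insert.1 hl with rfl | h
  · exact le_rfl
  · obtain ⟨ij, -, rfl⟩ := Finset.mem_image.1 h
    exact T.nonneg _ _

variable (T) in
/-- An edge: a segment between consecutive levels, on the first branch containing it. -/
structure IsEdgeIndex (a : Fin (T.N + 1) × ℝ × ℝ) : Prop where
  mem_left : a.2.1 ∈ T.levels
  mem_right : a.2.2 ∈ T.levels
  lt : a.2.1 < a.2.2
  consec : ∀ c ∈ T.levels, a.2.1 < c → a.2.2 ≤ c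
  le : a.2.2 ≤ T.g a.1 a.1
  first : ∀ j < a.1, T.g j a.1 < a.2.2

theorem finite_isEdgeIndex : {a | T.IsEdgeIndex a}.Finite :=
  (Set.finite_univ.prod (T.levels.finite_toSet.prod T.levels.finite_toSet)).subset
    fun _ ha => ⟨trivial, ha.mem_left, ha.mem_right⟩

variable (T) in
/-- The parametrization of an edge. -/
def edge (a : Fin (T.N + 1) × ℝ × ℝ) (t : I) : T.Tree :=
  T.pt a.1 (a.2.1 + t * (a.2.2 - a.2.1))

theorem IsEdgeIndex.mem_Icc {a : Fin (T.N + 1) × ℝ × ℝ} (ha : T.IsEdgeIndex a) (t : I) :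
    a.2.1 + t * (a.2.2 - a.2.1) ∈ Set.Icc 0 (T.g a.1 a.1) := by
  have h0 := nonneg_of_mem_levels ha.mem_left
  have h1 := ha.lt
  have h2 := ha.le
  have h3 := t.2.1
  have h4 := t.2.2
  constructor <;> nlinarith

theorem IsEdgeIndex.mem_Ioo {a : Fin (T.N + 1) × ℝ × ℝ} (ha : T.IsEdgeIndex a) {t : I}
    (ht : t ∈ Set.Ioo (0 : I) 1) : a.2.1 + t * (a.2.2 - a.2.1) ∈ Set.Ioo a.2.1 a.2.2 := by
  have h1 := ha.lt
  have h3 : (0 : ℝ) < t := ht.1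
  have h4 : (t : ℝ) < 1 := ht.2
  constructor <;> nlinarith

theorem IsEdgeIndex.notMem_levels {a : Fin (T.N + 1) × ℝ × ℝ} (ha : T.IsEdgeIndex a) {r : ℝ}
    (hr : r ∈ Set.Ioo a.2.1 a.2.2) : r ∉ T.levels := fun h =>
  absurd (ha.consec r h hr.1) (not_le.2 hr.2)

/-- Edges with a common interior height lie between the same consecutive levels. The separation
height is itself a level, so the branches agree up to the top, and `first` selects the same one. -/
theorem IsEdgeIndex.eq_of_mem {a b : Fin (T.N + 1) × ℝ × ℝ} (ha : T.IsEdgeIndex a)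
    (hb : T.IsEdgeIndex b) {r : ℝ} (har : r ∈ Set.Ioo a.2.1 a.2.2) (hbr : r ∈ Set.Ioo b.2.1 b.2.2)
    (hr : r ≤ T.g a.1 b.1) : a = b := by
  have h1 : a.2.1 = b.2.1 := by
    rcases lt_trichotomy a.2.1 b.2.1 with h | h | h
    · exact absurd (ha.consec _ hb.mem_left h) (not_le.2 (hbr.1.trans har.2))
    · exact h
    · exact absurd (hb.consec _ ha.mem_left h) (not_le.2 (har.1.trans hbr.2))
  have h2 : a.2.2 = b.2.2 :=
    le_antisymm (ha.consec _ hb.mem_right (h1 ▸ hb.lt)) (hb.consec _ ha.mem_right (h1 ▸ ha.lt))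
  have h3 : a.2.2 ≤ T.g a.1 b.1 := ha.consec _ (mem_levels _ _) (har.1.trans_le hr)
  have h4 : a.1 = b.1 := by
    rcases lt_trichotomy a.1 b.1 with h | h | h
    · exact absurd (hb.first _ h) (not_lt.2 (h2 ▸ h3))
    · exact h
    · exact absurd (ha.first _ h) (not_lt.2 (T.comm a.1 b.1 ▸ h3))
  exact Prod.ext h4 (Prod.ext h1 h2)

/-- Take the levels adjacent to s and the first branch agreeing with branch i up to the upper one.
-/
theorem exists_edge {i : Fin (T.N + 1)} {s : ℝ} (hs : s ∈ Set.Icc 0 (T.g i i))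
    (hl : s ∉ T.levels) : ∃ a, T.IsEdgeIndex a ∧ ∃ t, T.edge a t = T.pt i s := by
  have hne1 : (T.levels.filter (· < s)).Nonempty :=
    ⟨0, Finset.mem_filter.2 ⟨Finset.mem_insert_self _ _, hs.1.lt_of_ne fun h => hl (by
      rw [← h]; exact Finset.mem_insert_self _ _)⟩⟩
  have hne2 : (T.levels.filter (s < ·)).Nonempty :=
    ⟨T.g i i, Finset.mem_filter.2 ⟨mem_levels _ _, hs.2.lt_of_ne fun h => hl (by
      rw [h]; exact mem_levels _ _)⟩⟩
  obtain ⟨l, hl1, hl2⟩ := Finset.exists_max_image _ id hne1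
  obtain ⟨u, hu1, hu2⟩ := Finset.exists_min_image _ id hne2
  rw [Finset.mem_filter] at hl1 hu1
  have hcon : ∀ c ∈ T.levels, l < c → u ≤ c := fun c hc hlc => by
    rcases lt_trichotomy c s with h | h | h
    · exact absurd (hl2 c (Finset.mem_filter.2 ⟨hc, h⟩)) (not_le.2 hlc)
    · exact absurd (h ▸ hc) hl
    · exact hu2 c (Finset.mem_filter.2 ⟨hc, h⟩)
  have hui : u ≤ T.g i i := hcon _ (mem_levels _ _) (hl1.2.trans_le hs.2)
  have hex : ∃ j : Fin (T.N + 1), u ≤ T.g i j ∧ ∀ k < j, ¬ u ≤ T.g i k := by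
    obtain ⟨j, hj, hmin⟩ := WellFounded.has_min (wellFounded_lt (α := Fin (T.N + 1)))
      {j | u ≤ T.g i j} ⟨i, hui⟩
    exact ⟨j, hj, fun k hk h => hmin k h hk⟩
  obtain ⟨j, hj, hjmin⟩ := hex
  have hlu : 0 < u - l := by linarith [hl1.2, hu1.2]
  have ha : T.IsEdgeIndex (j, l, u) :=
    { mem_left := hl1.1
      mem_right := hu1.1
      lt := hl1.2.trans hu1.2
      consec := hcon
      le := hj.trans (T.comm i j ▸ T.le_left j i)
      first := fun k hk => by
        by_contra h
        refine hjmin k hk ((le_min hj ?_).trans (T.ultra i j k))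
        rw [T.comm]; exact not_lt.1 h }
  refine ⟨_, ha, ⟨(s - l) / (u - l), div_nonneg (by linarith [hl1.2]) hlu.le,
    (div_le_one hlu).2 (by linarith [hu1.2])⟩, ?_⟩
  have he : l + (s - l) / (u - l) * (u - l) = s := by
    rw [div_mul_cancel₀ _ hlu.ne']; ring
  change T.pt j (l + (s - l) / (u - l) * (u - l)) = _
  rw [he, pt_eq_pt ⟨hs.1, hu1.2.le.trans ha.le⟩ hs]
  exact ⟨rfl, hu1.2.le.trans (T.comm i j ▸ hj)⟩

theorem isFiniteTopologicalGraph : IsFiniteTopologicalGraph T.Tree := by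
  have : Finite {a | T.IsEdgeIndex a} := finite_isEdgeIndex.to_subtype
  obtain ⟨m, ⟨E⟩⟩ := Finite.exists_equiv_fin {a | T.IsEdgeIndex a}
  let a : Fin m → Fin (T.N + 1) × ℝ × ℝ := fun k => (E.symm k).1
  have ha : ∀ k, T.IsEdgeIndex (a k) := fun k => (E.symm k).2
  have hcont : ∀ k, Continuous (T.edge (a k)) := fun k => by
    refine (LipschitzWith.of_dist_le_mul
      (K := ⟨(a k).2.2 - (a k).2.1, sub_nonneg.2 (ha k).lt.le⟩) fun s t => ?_).continuous
    rw [edge, edge, dist_pt_self ((ha k).mem_Icc s) ((ha k).mem_Icc t), add_sub_add_left_eq_sub,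
      ← sub_mul, abs_mul, abs_of_nonneg (sub_nonneg.2 (ha k).lt.le), mul_comm]
    rfl
  refine ⟨{x | ∃ i, ∃ l ∈ T.levels, l ≤ T.g i i ∧ x = T.pt i l}, m,
    fun k => ⟨T.edge (a k), hcont k⟩, ?_, fun k => ⟨?_, ?_⟩, ?_, ?_, ?_⟩
  · refine ((Set.finite_univ (α := Fin (T.N + 1))).prod T.levels.finite_toSet).image
      (fun z : Fin (T.N + 1) × ℝ => T.pt z.1 z.2) |>.subset ?_
    rintro x ⟨i, l, hl, -, rfl⟩
    exact ⟨(i, l), ⟨trivial, hl⟩, rfl⟩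
  · exact ⟨(a k).1, (a k).2.1, (ha k).mem_left, (ha k).lt.le.trans (ha k).le, by simp [edge]⟩
  · exact ⟨(a k).1, (a k).2.2, (ha k).mem_right, (ha k).le, by simp [edge]⟩
  · rintro k s hs ⟨i, l, hl, hli, h⟩
    have h1 := ((pt_eq_pt ((ha k).mem_Icc s) ⟨nonneg_of_mem_levels hl, hli⟩).1 h).1
    exact (ha k).notMem_levels ((ha k).mem_Ioo hs) (h1 ▸ hl)
  · intro k k' s hs t ht h
    obtain ⟨h1, h2⟩ := (pt_eq_pt ((ha k).mem_Icc s) ((ha k').mem_Icc t)).1 h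
    have h3 := (ha k).eq_of_mem (ha k') ((ha k).mem_Ioo hs) (h1 ▸ (ha k').mem_Ioo ht) h2
    refine ⟨E.symm.injective (Subtype.ext h3), ?_⟩
    rw [← h3] at h1
    exact Subtype.ext (mul_right_cancel₀ (sub_pos.2 (ha k).lt).ne' (add_left_cancel h1))
  · intro x
    obtain ⟨i, s, hs, rfl⟩ := exists_pt x
    by_cases hl : s ∈ T.levels
    · exact Or.inl ⟨i, s, hl, hs.2, rfl⟩
    · obtain ⟨b, hb, t, ht⟩ := exists_edge hs hl
      refine Or.inr ⟨E ⟨b, hb⟩, t, ?_⟩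
      simpa [a] using ht

theorem isFiniteMetricGraph : IsFiniteMetricGraph T.Tree :=
  ⟨⟨T.pt 0 0⟩, isGeodesicSpace.isLengthSpace, isFiniteTopologicalGraph⟩

theorem firstBetti_eq_zero : firstBetti T.Tree = 0 :=
  have := contractibleSpace (T := T)
  firstBetti_eq_zero_of_contractible T.Tree

end TreeData

/-! ### Correspondences of bounded distortion -/

/-- There is a correspondence between `X` and `Y` of distortion at most `r`. -/
def HasCorr (X Y : Type*) [MetricSpace X] [MetricSpace Y] (r : ℝ) : Prop :=
  ∃ R : X → Y → Prop, IsCorrespondence R ∧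
    ∀ x y x' y', R x y → R x' y' → |dist x x' - dist y y'| ≤ r

section Corr

variable {X Y Z : Type*} [MetricSpace X] [MetricSpace Y] [MetricSpace Z]

theorem HasCorr.comp {r s : ℝ} (h₁ : HasCorr X Y r) (h₂ : HasCorr Y Z s) :
    HasCorr X Z (r + s) := by
  obtain ⟨R, ⟨hR1, hR2⟩, hR⟩ := h₁
  obtain ⟨S, ⟨hS1, hS2⟩, hS⟩ := h₂
  refine ⟨fun x z => ∃ y, R x y ∧ S y z, ⟨fun x => ?_, fun z => ?_⟩, ?_⟩
  · obtain ⟨y, hy⟩ := hR1 x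
    obtain ⟨z, hz⟩ := hS1 y
    exact ⟨z, y, hy, hz⟩
  · obtain ⟨y, hy⟩ := hS2 z
    obtain ⟨x, hx⟩ := hR2 y
    exact ⟨x, y, hx, hy⟩
  · rintro x z x' z' ⟨y, h1, h2⟩ ⟨y', h1', h2'⟩
    exact (abs_sub_le _ (dist y y') _).trans (add_le_add (hR _ _ _ _ h1 h1') (hS _ _ _ _ h2 h2'))

theorem distortion_nonneg (R : X → Y → Prop) : 0 ≤ distortion R :=
  Real.sSup_nonneg (by rintro _ ⟨x, y, x', y', -, -, rfl⟩; exact abs_nonneg _)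

theorem dGH_nonneg : 0 ≤ dGH X Y :=
  mul_nonneg (by norm_num)
    (Real.sInf_nonneg (by rintro _ ⟨R, -, rfl⟩; exact distortion_nonneg R))

theorem HasCorr.dGH_le [Nonempty X] {r : ℝ} (h : HasCorr X Y r) : dGH X Y ≤ r / 2 := by
  obtain ⟨R, hR, hr⟩ := h
  obtain ⟨x⟩ := ‹Nonempty X›
  obtain ⟨y, hy⟩ := hR.1 x
  have h1 : distortion R ≤ r := csSup_le ⟨_, x, y, x, y, hy, hy, rfl⟩
    (by rintro _ ⟨x, y, x', y', h, h', rfl⟩; exact hr _ _ _ _ h h')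
  have h2 : sInf {r : ℝ | ∃ R : X → Y → Prop, IsCorrespondence R ∧ r = distortion R} ≤
      distortion R :=
    csInf_le ⟨0, by rintro _ ⟨R, -, rfl⟩; exact distortion_nonneg R⟩ ⟨R, hR, rfl⟩
  unfold dGH
  linarith

theorem hasCorr_of_dGH_lt [Nonempty X] [Nonempty Y] [BoundedSpace X] [BoundedSpace Y] {d : ℝ}
    (h : dGH X Y < d) : HasCorr X Y (2 * d) := by
  have h1 : sInf {r : ℝ | ∃ R : X → Y → Prop, IsCorrespondence R ∧ r = distortion R} < 2 * d := by
    unfold dGH at h; linarith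
  have hne : {r : ℝ | ∃ R : X → Y → Prop, IsCorrespondence R ∧ r = distortion R}.Nonempty :=
    ⟨_, fun _ _ => True, ⟨fun _ => ⟨Classical.arbitrary Y, trivial⟩,
      fun _ => ⟨Classical.arbitrary X, trivial⟩⟩, rfl⟩
  obtain ⟨_, ⟨R, hR, rfl⟩, h2⟩ := exists_lt_of_csInf_lt hne h1
  refine ⟨R, hR, fun x y x' y' hx hx' => le_trans ?_ h2.le⟩
  unfold distortion
  -- Boundedness of both spaces ensures that `sSup` is a genuine supremum.
  refine le_csSup ?_ ⟨x, y, x', y', hx, hx', rfl⟩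
  refine ⟨Metric.diam (Set.univ : Set X) + Metric.diam (Set.univ : Set Y), ?_⟩
  rintro _ ⟨x, y, x', y', -, -, rfl⟩
  have e1 := Metric.dist_le_diam_of_mem (BoundedSpace.bounded_univ (α := X)) (Set.mem_univ x)
    (Set.mem_univ x')
  have e2 := Metric.dist_le_diam_of_mem (BoundedSpace.bounded_univ (α := Y)) (Set.mem_univ y)
    (Set.mem_univ y')
  have e3 := dist_nonneg (x := x) (y := x')
  have e4 := dist_nonneg (x := y) (y := y')
  rw [abs_le]
  constructor <;> linarith

/-! ### Stability of hyperbolicity and of Gromov products -/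

/-- Each side of the four point inequality changes by at most 2r, and 4r = 2 · 2r. -/
theorem HasCorr.isHyperbolic {r δ : ℝ} (h : HasCorr X Y r) (hδ : IsHyperbolic Y δ) :
    IsHyperbolic X (δ + 2 * r) := by
  obtain ⟨R, hR, hr⟩ := h
  intro x y w z
  obtain ⟨x', hx⟩ := hR.1 x
  obtain ⟨y', hy⟩ := hR.1 y
  obtain ⟨w', hw⟩ := hR.1 w
  obtain ⟨z', hz⟩ := hR.1 z
  have h1 := abs_le.1 (hr _ _ _ _ hx hy)
  have h2 := abs_le.1 (hr _ _ _ _ hw hz)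
  have h3 := abs_le.1 (hr _ _ _ _ hx hw)
  have h4 := abs_le.1 (hr _ _ _ _ hy hz)
  have h5 := abs_le.1 (hr _ _ _ _ hx hz)
  have h6 := abs_le.1 (hr _ _ _ _ hy hw)
  have h7 := hδ x' y' w' z'
  rcases le_total (dist x' w' + dist y' z') (dist x' z' + dist y' w') with h8 | h8
  · rw [max_eq_right h8] at h7
    have := le_max_right (dist x w + dist y z) (dist x z + dist y w)
    linarith
  · rw [max_eq_left h8] at h7
    have := le_max_left (dist x w + dist y z) (dist x z + dist y w)
    linarith

theorem hyp_nonneg : 0 ≤ hyp X := Real.sInf_nonneg fun _ h => h.1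

theorem hyp_le {δ : ℝ} (h0 : 0 ≤ δ) (h : IsHyperbolic X δ) : hyp X ≤ δ :=
  csInf_le ⟨0, fun _ h => h.1⟩ ⟨h0, h⟩

theorem isHyperbolic_hyp [BoundedSpace X] : IsHyperbolic X (hyp X) := by
  have hne : {δ : ℝ | 0 ≤ δ ∧ IsHyperbolic X δ}.Nonempty := by
    refine ⟨Metric.diam (Set.univ : Set X), Metric.diam_nonneg, fun x y w z => ?_⟩
    have e1 := Metric.dist_le_diam_of_mem (BoundedSpace.bounded_univ (α := X)) (Set.mem_univ x)
      (Set.mem_univ y)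
    have e2 := Metric.dist_le_diam_of_mem (BoundedSpace.bounded_univ (α := X)) (Set.mem_univ w)
      (Set.mem_univ z)
    have e3 : 0 ≤ max (dist x w + dist y z) (dist x z + dist y w) := le_max_of_le_left (by positivity)
    linarith
  intro x y w z
  have : (dist x y + dist w z - max (dist x w + dist y z) (dist x z + dist y w)) / 2 ≤ hyp X :=
    le_csInf hne fun δ hδ => by linarith [hδ.2 x y w z]
  linarith

/-- Chains transfer link by link with prescribed ends. Each link involves three distances with
weight 1/2, whence 3r/2. -/
theorem gromovProdInf_le_of_corr {R : X → Y → Prop} {r : ℝ} (hR : IsCorrespondence R)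
    (hr : ∀ x y x' y', R x y → R x' y' → |dist x x' - dist y y'| ≤ r) {p x y : X} {p' x' y' : Y}
    (hp : R p p') (hx : R x x') (hy : R y y') :
    gromovProdInf p x y ≤ gromovProdInf p' x' y' + 3 / 2 * r := by
  have hg : ∀ {u v u' v'}, R u u' → R v v' →
      gromovProd p u v ≤ gromovProd p' u' v' + 3 / 2 * r := by
    intro u v u' v' hu hv
    have h1 := abs_le.1 (hr _ _ _ _ hp hu)
    have h2 := abs_le.1 (hr _ _ _ _ hp hv)
    have h3 := abs_le.1 (hr _ _ _ _ hu hv)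
    simp only [gromovProd]
    linarith
  choose f hf using hR.1
  refine csSup_le (chain_nonempty p x y) ?_
  rintro _ ⟨n, c, rfl, rfl, rfl⟩
  let c' : ℕ → Y := fun i => if i = 0 then x' else if i = n + 1 then y' else f (c i)
  have hc : ∀ i, R (c i) (c' i) := fun i => by
    simp only [c']
    split_ifs with h1 h2
    · rwa [h1]
    · rwa [h2]
    · exact hf _
  have h1 : chainMin p' n c' ≤ gromovProdInf p' x' y' :=
    le_csSup (chain_bddAbove p' x' y') ⟨n, c', by simp [c'], by simp [c'], rfl⟩
  have h2 : chainMin p n c - 3 / 2 * r ≤ chainMin p' n c' := by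
    refine Finset.le_inf' _ _ fun i hi => ?_
    have h3 : chainMin p n c ≤ gromovProd p (c i) (c (i + 1)) := Finset.inf'_le _ hi
    linarith [hg (hc i) (hc (i + 1))]
  linarith

theorem gromovProd_le_of_corr {R : X → Y → Prop} {r : ℝ}
    (hr : ∀ x y x' y', R x y → R x' y' → |dist x x' - dist y y'| ≤ r) {p x y : X} {p' x' y' : Y}
    (hp : R p p') (hx : R x x') (hy : R y y') :
    gromovProd p' x' y' ≤ gromovProd p x y + 3 / 2 * r := by
  have h1 := abs_le.1 (hr _ _ _ _ hp hx)
  have h2 := abs_le.1 (hr _ _ _ _ hp hy)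
  have h3 := abs_le.1 (hr _ _ _ _ hx hy)
  simp only [gromovProd]
  linarith

theorem isHyperbolic_zero_of_gromovProdInf_le
    (h : ∀ p x y : X, gromovProdInf p x y ≤ gromovProd p x y) : IsHyperbolic X 0 := by
  intro x y w z
  have h1 := (min_le_min (gromovProd_le_gromovProdInf x w y)
    (gromovProd_le_gromovProdInf x y z)).trans ((min_gromovProdInf_le x w y z).trans
    (h x w z))
  simp only [gromovProd] at h1
  have c1 := dist_comm w y
  rcases min_le_iff.1 h1 with h2 | h2
  · have := le_max_right (dist x w + dist y z) (dist x z + dist y w)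
    linarith
  · have := le_max_left (dist x w + dist y z) (dist x z + dist y w)
    linarith

/-! ### Gromov's tree -/

theorem treeDist_le_dist (p x y : X) : treeDist p x y ≤ dist x y := by
  have := gromovProd_le_gromovProdInf p x y
  simp only [gromovProd] at this
  simp only [treeDist]
  linarith

/-- The canonical projection to Gromov's tree. -/
def toGromovTree (p : X) (x : X) : GromovTree X p := SeparationQuotient.mk (X := PreGromovTree X p) x

theorem dist_toGromovTree (p x y : X) :
    dist (toGromovTree p x) (toGromovTree p y) = treeDist p x y := rfl

theorem surjective_toGromovTree (p : X) : Function.Surjective (toGromovTree p) :=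
  SeparationQuotient.surjective_mk (X := PreGromovTree X p)

theorem boundedSpace_gromovTree [BoundedSpace X] (p : X) : BoundedSpace (GromovTree X p) := by
  refine ⟨Metric.isBounded_iff.2 ⟨Metric.diam (Set.univ : Set X), fun a _ b _ => ?_⟩⟩
  obtain ⟨x, rfl⟩ := surjective_toGromovTree p a
  obtain ⟨y, rfl⟩ := surjective_toGromovTree p b
  rw [dist_toGromovTree]
  exact (treeDist_le_dist p x y).trans
    (Metric.dist_le_diam_of_mem BoundedSpace.bounded_univ trivial trivial)

/-- The projection shortens distances by twice the difference of the two products. -/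
theorem hasCorr_gromovTree (p : X) {M : ℝ}
    (h : ∀ x y, gromovProdInf p x y ≤ gromovProd p x y + M) :
    HasCorr X (GromovTree X p) (2 * M) := by
  refine ⟨fun x a => a = toGromovTree p x, ⟨fun x => ⟨_, rfl⟩, fun a => ?_⟩, ?_⟩
  · obtain ⟨x, rfl⟩ := surjective_toGromovTree p a
    exact ⟨x, rfl⟩
  · rintro x _ y _ rfl rfl
    have h1 := treeDist_le_dist p x y
    have h2 := h x y
    rw [dist_toGromovTree, abs_of_nonneg (by linarith)]
    simp only [gromovProd] at h2
    simp only [treeDist]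
    linarith

/-- This matches `TreeData.dist_pt`: branches of Gromov's tree ending at x and x' separate at height
`gromovProdInf p x x'`. It follows from the ultrametric inequality along y, x, x', y'. -/
theorem treeDist_eq_of_below {p x x' y y' : X} (hy : Below p y x) (hy' : Below p y' x') :
    treeDist p y y' = dist p y + dist p y' -
      2 * min (min (dist p y) (dist p y')) (gromovProdInf p x x') := by
  have e : gromovProdInf p y y' = min (min (dist p y) (dist p y')) (gromovProdInf p x x') := by
    have h1 : dist p y ≤ gromovProdInf p y x :=
      (gromovProd_eq_of_below hy).symm.le.trans (gromovProd_le_gromovProdInf _ _ _)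
    have h2 : dist p y' ≤ gromovProdInf p y' x' :=
      (gromovProd_eq_of_below hy').symm.le.trans (gromovProd_le_gromovProdInf _ _ _)
    have h3 := gromovProdInf_le_left p y y'
    have h4 := gromovProdInf_comm p y y' ▸ gromovProdInf_le_left p y' y
    refine le_antisymm (le_min (le_min h3 h4) ?_) ?_
    · refine le_trans (le_min ?_ (h4.trans h2)) (min_gromovProdInf_le p x y' x')
      refine le_trans (le_min ?_ le_rfl) (min_gromovProdInf_le p x y y')
      exact gromovProdInf_comm p y x ▸ h3.trans h1
    · refine le_trans (le_min ?_ ?_) (min_gromovProdInf_le p y x' y')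
      · refine le_trans (le_min ?_ (min_le_right _ _)) (min_gromovProdInf_le p y x x')
        exact ((min_le_left _ _).trans (min_le_left _ _)).trans h1
      · rw [gromovProdInf_comm p x' y']
        exact ((min_le_left _ _).trans (min_le_right _ _)).trans h2
  rw [treeDist, e]

/-- Gromov's tree of a compact geodesic space is a limit of finite metric trees. -/
theorem exists_tree_hasCorr [CompactSpace X] (hX : IsGeodesicSpace X) (p : X) {ε : ℝ}
    (hε : 0 < ε) : ∃ T : TreeData, HasCorr (GromovTree X p) T.Tree (2 * ε) := by
  obtain ⟨S, -, hSf, hS⟩ := finite_cover_balls_of_compact (isCompact_univ (X := X)) hε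
  have hSne : S.Nonempty := by
    obtain ⟨x, hx, -⟩ := Set.mem_iUnion₂.1 (hS (Set.mem_univ p))
    exact ⟨x, hx⟩
  have := hSf.to_subtype
  have := hSne.to_subtype
  obtain ⟨m, ⟨E⟩⟩ := Finite.exists_equiv_fin S
  obtain ⟨N, rfl⟩ : ∃ N, m = N + 1 := Nat.exists_eq_succ_of_ne_zero fun h => by
    subst h; exact (E (Classical.arbitrary S)).elim0
  let x : Fin (N + 1) → X := fun i => (E.symm i).1
  have hx : ∀ u, ∃ i, dist u (x i) < ε := fun u => by
    obtain ⟨v, hv, huv⟩ := Set.mem_iUnion₂.1 (hS (Set.mem_univ u))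
    exact ⟨E ⟨v, hv⟩, by simpa [x] using huv⟩
  let T : TreeData :=
    { N := N
      g := fun i j => gromovProdInf p (x i) (x j)
      comm := fun i j => gromovProdInf_comm _ _ _
      nonneg := fun i j => (gromovProd_nonneg _ _ _).trans (gromovProd_le_gromovProdInf _ _ _)
      ultra := fun i j k => min_gromovProdInf_le _ _ _ _ }
  have hgii : ∀ i, T.g i i = dist p (x i) := fun i => gromovProdInf_self p (x i)
  have hself : ∀ u, treeDist p u u = 0 := fun u => by
    rw [treeDist, gromovProdInf_self]; ring
  have hcomm : ∀ u v, treeDist p u v = treeDist p v u := fun u v => by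
    rw [treeDist, treeDist, gromovProdInf_comm]; ring
  -- `T` is the subtree spanned by p and an ε-net, isometric to its image in Gromov's tree; pairs at
  -- distance at most ε correspond, so the distortion is at most 2ε.
  refine ⟨T, fun a τ => ∃ u, a = toGromovTree p u ∧ ∃ i y, Below p y (x i) ∧
    τ = T.pt i (dist p y) ∧ treeDist p u y ≤ ε, ⟨fun a => ?_, fun τ => ?_⟩, ?_⟩
  · obtain ⟨u, rfl⟩ := surjective_toGromovTree p a
    obtain ⟨i, hi⟩ := hx u
    exact ⟨_, u, rfl, i, x i, by simp [Below], rfl, (treeDist_le_dist _ _ _).trans hi.le⟩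
  · obtain ⟨i, s, hs, rfl⟩ := TreeData.exists_pt τ
    obtain ⟨y, hy, hyi⟩ := exists_below hX p (x i) hs.1 (hgii i ▸ hs.2)
    exact ⟨_, y, rfl, i, y, hyi, by rw [hy], (hself y).trans_le hε.le⟩
  · rintro _ _ _ _ ⟨u, rfl, i, y, hy, rfl, hu⟩ ⟨u', rfl, i', y', hy', rfl, hu'⟩
    have hm : ∀ {i y}, Below p y (x i) → dist p y ∈ Set.Icc 0 (T.g i i) := fun {i y} h =>
      ⟨dist_nonneg, by
        rw [hgii]
        have : dist p (x i) = dist p y + dist y (x i) := h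
        have := dist_nonneg (x := y) (y := x i)
        linarith⟩
    rw [dist_toGromovTree, TreeData.dist_pt (hm hy) (hm hy'),
      ← show treeDist p y y' = _ from treeDist_eq_of_below hy hy', abs_le]
    have h1 := treeDist_triangle p u y u'
    have h2 := treeDist_triangle p y y' u'
    have h3 := treeDist_triangle p y u y'
    have h4 := treeDist_triangle p u u' y'
    have h5 := hcomm u y
    have h6 := hcomm u' y'
    constructor <;> linarith

end Corr

/-! ### The main estimates -/

section Main

variable {X : Type*} [MetricSpace X]

theorem bddBelow_graphDelta (n : ℕ) : BddBelow {r : ℝ | ∃ (G : Type) (_ : MetricSpace G),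
    IsFiniteMetricGraph G ∧ firstBetti G ≤ n ∧ r = dGH X G} :=
  ⟨0, by rintro _ ⟨G, _, -, -, rfl⟩; exact dGH_nonneg⟩

theorem graphDelta_nonneg (n : ℕ) : 0 ≤ graphDelta X n :=
  Real.sInf_nonneg (by rintro _ ⟨G, _, -, -, rfl⟩; exact dGH_nonneg)

theorem graphDelta_set_nonempty (n : ℕ) : {r : ℝ | ∃ (G : Type) (_ : MetricSpace G),
    IsFiniteMetricGraph G ∧ firstBetti G ≤ n ∧ r = dGH X G}.Nonempty := by
  -- The one-point tree keeps the infimum from being that of an empty set.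
  let T : TreeData := ⟨0, fun _ _ => 0, fun _ _ => rfl, fun _ _ => le_rfl, fun _ _ _ => by simp⟩
  exact ⟨_, T.Tree, inferInstance, TreeData.isFiniteMetricGraph,
    by rw [TreeData.firstBetti_eq_zero]; simp, rfl⟩

theorem graphDelta_le_zero (n : ℕ) : graphDelta X n ≤ graphDelta X 0 := by
  refine csInf_le_csInf (bddBelow_graphDelta n) (graphDelta_set_nonempty 0) ?_
  rintro _ ⟨G, i, h1, h2, rfl⟩
  exact ⟨G, i, h1, h2.trans (by simp), rfl⟩

/-- Every graph competing in the definition of `graphDelta` yields a correspondence. -/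
theorem exists_hasCorr_of_graphDelta_lt [Nonempty X] [BoundedSpace X] {n : ℕ} {d : ℝ}
    (h : graphDelta X n < d) : ∃ (G : Type) (_ : MetricSpace G),
      IsFiniteMetricGraph G ∧ firstBetti G ≤ n ∧ HasCorr X G (2 * d) := by
  obtain ⟨_, ⟨G, i, h1, h2, rfl⟩, h3⟩ := exists_lt_of_csInf_lt (graphDelta_set_nonempty n) h
  have := h1.nonempty
  have := h1.isFiniteTopologicalGraph.compactSpace
  exact ⟨G, i, h1, h2, hasCorr_of_dGH_lt h3⟩

/-- Finite trees approximate Gromov's tree arbitrarily well. The space `Y` need not be X, so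
Gromov's tree of a nearby graph may be used. -/
theorem HasCorr.graphDelta_zero_le [Nonempty X] {Y : Type*} [MetricSpace Y] [CompactSpace Y]
    (hY : IsGeodesicSpace Y) (p : Y) {r : ℝ} (h : HasCorr X (GromovTree Y p) (2 * r)) :
    graphDelta X 0 ≤ r := by
  refine le_of_forall_pos_le_add fun ε hε => ?_
  obtain ⟨T, hT⟩ := exists_tree_hasCorr hY p hε
  have h1 := (h.comp hT).dGH_le
  have h2 : graphDelta X 0 ≤ dGH X T.Tree := csInf_le (bddBelow_graphDelta 0)
    ⟨T.Tree, inferInstance, TreeData.isFiniteMetricGraph, TreeData.firstBetti_eq_zero.le, rfl⟩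
  linarith

theorem graphDelta_zero_le_dGH [CompactSpace X] (hX : IsGeodesicSpace X) (p : X) :
    graphDelta X 0 ≤ dGH X (GromovTree X p) := by
  have : Nonempty X := ⟨p⟩
  have := boundedSpace_gromovTree p
  have : Nonempty (GromovTree X p) := ⟨toGromovTree p p⟩
  refine le_of_forall_pos_le_add fun ε hε => ?_
  exact (hasCorr_of_dGH_lt (lt_add_of_pos_right _ hε)).graphDelta_zero_le hX p

theorem dGH_gromovTree_le [CompactSpace X] (p : X) :
    dGH X (GromovTree X p) / 6 ≤ graphDelta X 0 := by
  have : Nonempty X := ⟨p⟩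
  refine le_of_forall_pos_le_add fun ε hε => ?_
  obtain ⟨G, _, h1, h2, R, hR, hr⟩ := exists_hasCorr_of_graphDelta_lt (X := X)
    (lt_add_of_pos_right (graphDelta X 0) hε)
  obtain ⟨p', hp⟩ := hR.1 p
  -- With d = `graphDelta X 0 + ε` the distortion is 2d, so passing to the tree and back costs 3d
  -- each way.
  have h3 : ∀ x y, gromovProdInf p x y ≤ gromovProd p x y + 6 * (graphDelta X 0 + ε) := by
    intro x y
    obtain ⟨x', hx⟩ := hR.1 x
    obtain ⟨y', hy⟩ := hR.1 y
    have e1 := gromovProdInf_le_of_corr hR hr hp hx hy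
    have e2 := h1.gromovProdInf_le_of_firstBetti_eq_zero h2 p' x' y'
    have e3 := gromovProd_le_of_corr hr hp hx hy
    linarith
  have h4 := (hasCorr_gromovTree p h3).dGH_le
  linarith

theorem one_le_logb (n : ℕ) : 1 ≤ Real.logb 2 (4 * (n : ℝ) + 4) := by
  rw [Real.le_logb_iff_rpow_le one_lt_two (by positivity), Real.rpow_one]
  linarith [n.cast_nonneg (α := ℝ)]

theorem graphDelta_zero_le_logb [CompactSpace X] [Nonempty X] (n : ℕ) :
    graphDelta X 0 ≤
      Real.logb 2 (4 * (n : ℝ) + 4) * (5 * graphDelta X n + hyp X) := by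
  set L := Real.logb 2 (4 * (n : ℝ) + 4)
  have hL : 1 ≤ L := one_le_logb n
  have key : ∀ d, graphDelta X n < d → graphDelta X 0 ≤ L * (5 * d + hyp X) := by
    intro d hd
    have hd0 : 0 ≤ d := (graphDelta_nonneg n).trans hd.le
    obtain ⟨G, _, h1, h2, h3⟩ := exists_hasCorr_of_graphDelta_lt hd
    have := h1.isFiniteTopologicalGraph.compactSpace
    have h3' : HasCorr G X (2 * d) := by
      obtain ⟨R, hR, hr⟩ := h3
      refine ⟨fun y x => R x y, ⟨hR.2, hR.1⟩, fun x y x' y' h h' => ?_⟩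
      rw [abs_sub_comm]; exact hr _ _ _ _ h h'
    obtain ⟨q⟩ := h1.nonempty
    have h4 := h3'.isHyperbolic isHyperbolic_hyp
    have h5 : 0 ≤ hyp X + 2 * (2 * d) := add_nonneg hyp_nonneg (by linarith)
    have h6 := hasCorr_gromovTree q (h1.gromovProdInf_le h2 h5 h4 q)
    have h7 := h3.comp h6
    rw [← mul_add] at h7
    have h8 := h7.graphDelta_zero_le h1.isLengthSpace.isGeodesicSpace q
    -- The bound obtained is d + L(hyp X + 4d); since L ≥ 1, the first d is absorbed into 5Ld.
    nlinarith
  refine le_of_forall_pos_le_add fun ε hε => ?_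
  have hL0 : 0 < 5 * L := by linarith
  refine (key (graphDelta X n + ε / (5 * L)) (lt_add_of_pos_right _ (by positivity))).trans
    (le_of_eq ?_)
  field_simp
  ring

/-- Metric trees are 0-hyperbolic, and distortion 2d adds at most 4d to the hyperbolicity. -/
theorem hyp_div_four_le [CompactSpace X] [Nonempty X] : hyp X / 4 ≤ graphDelta X 0 := by
  refine le_of_forall_pos_le_add fun ε hε => ?_
  obtain ⟨G, _, h1, h2, h3⟩ := exists_hasCorr_of_graphDelta_lt (X := X)
    (lt_add_of_pos_right (graphDelta X 0) hε)
  have h4 := h3.isHyperbolic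
    (isHyperbolic_zero_of_gromovProdInf_le (h1.gromovProdInf_le_of_firstBetti_eq_zero h2))
  have h5 := graphDelta_nonneg (X := X) 0
  have h6 := hyp_le (by linarith) h4
  linarith

theorem IsFiniteMetricGraph.graphDelta_zero_le (hX : IsFiniteMetricGraph X) {n : ℕ}
    (hn : firstBetti X ≤ n) : graphDelta X 0 ≤ Real.logb 2 (4 * (n : ℝ) + 4) * hyp X := by
  have := hX.isFiniteTopologicalGraph.compactSpace
  obtain ⟨p⟩ := hX.nonempty
  have : Nonempty X := ⟨p⟩
  exact (hasCorr_gromovTree p (hX.gromovProdInf_le hn hyp_nonneg isHyperbolic_hyp p)).graphDelta_zero_le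
    hX.isLengthSpace.isGeodesicSpace p

end Main

end TreeApprox

end

/-! ### The theorem -/

theorem mainTheorem4 {X : Type*} [MetricSpace X] [CompactSpace X]
    (hX : TreeApprox.IsGeodesicSpace X) (β : ℕ) (hβ : TreeApprox.firstBetti X = β) (p : X) :
    (TreeApprox.dGH X (TreeApprox.GromovTree X p) / 6 ≤ TreeApprox.graphDelta X 0 ∧
      TreeApprox.graphDelta X 0 ≤ TreeApprox.dGH X (TreeApprox.GromovTree X p)) ∧
    (∀ n : ℕ, TreeApprox.graphDelta X n ≤ TreeApprox.graphDelta X 0 ∧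
      TreeApprox.graphDelta X 0 ≤
        Real.logb 2 (4 * (n : ℝ) + 4) * (5 * TreeApprox.graphDelta X n + TreeApprox.hyp X)) ∧
    (TreeApprox.IsFiniteMetricGraph X →
      TreeApprox.hyp X / 4 ≤ TreeApprox.graphDelta X 0 ∧
      TreeApprox.graphDelta X 0 ≤ Real.logb 2 (4 * (β : ℝ) + 4) * TreeApprox.hyp X) := by
  have : Nonempty X := ⟨p⟩
  exact ⟨⟨TreeApprox.dGH_gromovTree_le p, TreeApprox.graphDelta_zero_le_dGH hX p⟩,
    fun n => ⟨TreeApprox.graphDelta_le_zero n, TreeApprox.graphDelta_zero_le_logb n⟩,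
    fun hG => ⟨TreeApprox.hyp_div_four_le, hG.graphDelta_zero_le hβ.le⟩⟩
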